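/- Let $M_g$ be a closed connected oriented surface of genus $g\ge 1$, and let $F$ be a brane tiling of $M_g$: a tiling of $M_g$ by polygons whose 1-skeleton $\Gamma$ is a bipartite graph with vertices coloured black and white (and without univalent vertices, as is automatic when the polygons are convex). Let $Q$ be the dual quiver of $F$: its vertices are the tiles, and its arrows are the edges of the tiling, each crossing its edge so that arrows run clockwise around the black vertices and anticlockwise around the white ones. Let $\tilde F$ and $\tilde Q$ be the lifts of $F$ and $Q$ to the universal cover $\tilde M_g$. For paths $u$, $v$, write $uv$ for first $u$, then $v$; write $t(u)$ and $h(u)$ for the tiles in which $u$ starts and ends. For an arrow $a$, the two broken loops $\omega^{br}_{a,B}$, $\omega^{br}_{a,W}$ are the paths from $h(a)$ to $t(a)$ that complete $a$ to a single revolution around the black, respectively white, vertex of the edge $a$. A simple loop $\omega_j$ at a tile $j$ is a closed path from $j$ to $j$ consisting of a single revolution around one of the vertices of $j$. Let $A_F=\mathbb{C}Q/\langle \omega^{br}_{a,B}-\omega^{br}_{a,W} : a \text{ an arrow of } Q\rangle$, which is the quotient of $\mathbb{C}Q$ by the cyclic derivatives of the superpotential $W=\sum(\text{black cycles})-\sum(\text{white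 cycles})$. Paths $u,v$ in $Q$ with the same start and end (length zero allowed) are F-term equivalent, $u\sim v$, if they are equal in $A_F$; paths in $\tilde Q$ with the same start and end are F-term equivalent if their projections to $Q$ are. The tiling $F$ is consistent if, for all paths $u$, $v$ in $Q$ from a tile $i$ to a tile $j$, $u\omega_j^n\sim v\omega_j^n$ for some $n\ge 0$ and some simple loop $\omega_j$ implies $u\sim v$. A path in $\tilde Q$ is minimal if it is not F-term equivalent to any path that contains a simple loop. **Lemma.** If $F$ is consistent, then $F$ satisfies condition MR2 and its dual: 1. for any two tiles $i,j$ of $\tilde F$ there is an arrow $a$ from $j$ to some tile $k$ such that some minimal path from $i$ to $k$ passes along $a$; 2. for any two tiles $i,j$ of $\tilde F$ there is an arrow $a$ from some tile $k$ to $j$ such that some minimal path from $k$ to $i$ passes along $a$. -/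

import Mathlib

open CategoryTheory

universe u

/-- The two colours of the vertices of the bipartite graph of a brane tiling. -/
inductive VertexColour : Type
  | black
  | white

/-- A brane tiling of genus `g`: a tiling by polygons of a closed connected oriented surface of
genus `g`, whose 1-skeleton is a bipartite graph with black and white vertices, given by its
incidence data (a bipartite combinatorial map).

Every edge of the tiling is an arrow of the dual quiver: the arrow `e` crosses the edge from the
tile `tail e` to the tile `head e`, with the black end of the edge on its right, so that arrows run
clockwise around black vertices and anticlockwise around white ones.  `next c e` is the arrow that
follows `e` in the rotation around the end of colour `c` of the edge `e`. The vertices of colour `c`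
are therefore the cycles of the permutation `next c`, and the arrows leaving the tile `i`, in their
cyclic order along the boundary of the polygon `i`, form one cycle of
`next black * (next white)⁻¹`. -/
structure BraneTiling (g : ℕ) where
  Tile : Type u
  Edge : Type u
  finite_edge : Finite Edge
  nonempty_edge : Nonempty Edge
  tail : Edge → Tile
  head : Edge → Tile
  next : VertexColour → Equiv.Perm Edge
  /-- The arrow following `e` around either end of `e` starts in the tile in which `e` ends. -/
  tail_next : ∀ c e, tail (next c e) = head e
  /-- Every tile has an edge. -/
  tail_surjective : Function.Surjective tail
  /-- Every tile is a single polygon: the arrows leaving it form one cycle. -/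
  sameCycle_of_tail_eq : ∀ e f, tail e = tail f →
    (next .black * (next .white)⁻¹).SameCycle e f
  /-- No vertex is univalent. (At a univalent vertex a polygon would have two
  consecutive sides glued to each other, hence an interior angle of 360 degrees.) -/
  next_ne : ∀ c e, next c e ≠ e
  /-- The surface is connected. -/
  connected : ∀ e f, ∃ π ∈ Subgroup.closure (Set.range next), π e = f
  /-- The Euler characteristic: vertices minus edges plus tiles is `2 - 2 g`. -/
  euler : (Nat.card (_root_.Quotient (Equiv.Perm.SameCycle.setoid (next .black))) : ℤ)
      + Nat.card (_root_.Quotient (Equiv.Perm.SameCycle.setoid (next .white)))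
      - Nat.card Edge + Nat.card Tile = 2 - 2 * (g : ℤ)

namespace BraneTiling

variable {g : ℕ} (F : BraneTiling.{u} g)

/-- The dual quiver `Q`: its vertices are the tiles, its arrows the edges of the tiling. Paths
along tiles are paths in this quiver, and `p.comp q` is `p` followed by `q`. -/
instance dualQuiver : Quiver F.Tile where
  Hom i j := {e : F.Edge // F.tail e = i ∧ F.head e = j}

/-- An edge as an arrow of the dual quiver. -/
def arrow (e : F.Edge) : F.tail e ⟶ F.head e := ⟨e, rfl, rfl⟩

/-- The path `e₁ e₂ … e_k`, where `e₁, e₂, …` are the successors of `e` in the rotation around its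
end of colour `c`. -/
def follow (c : VertexColour) (e : F.Edge) :
    (k : ℕ) → Quiver.Path (F.head e) (F.head ((F.next c)^[k] e))
  | 0 => Quiver.Path.nil
  | k + 1 => (follow c e k).cons
      ⟨(F.next c)^[k + 1] e,
        by rw [Function.iterate_succ_apply']; exact F.tail_next c _, rfl⟩

theorem head_iterate (c : VertexColour) (e : F.Edge) :
    F.head ((F.next c)^[Function.minimalPeriod (F.next c) e - 1] e) = F.tail e := by
  have := F.finite_edge
  have hpos : 0 < Function.minimalPeriod (F.next c) e :=
    Function.minimalPeriod_pos_of_mem_periodicPts ((F.next c).injective.mem_periodicPts e)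
  rw [← F.tail_next c, ← Function.iterate_succ_apply' (F.next c), Nat.succ_eq_add_one,
    Nat.sub_add_cancel hpos, Function.iterate_minimalPeriod]

/-- The broken loop of `e` around its vertex of colour `c`: the path from `h(e)` to `t(e)` that
completes `e` to a single revolution around that vertex. -/
noncomputable def brokenLoop (c : VertexColour) (e : F.Edge) : Quiver.Path (F.head e) (F.tail e) :=
  (F.follow c e (Function.minimalPeriod (F.next c) e - 1)).cast rfl (F.head_iterate c e)

variable {F}

/-- The simple loops at a tile: a single revolution around one of the vertices of that tile. -/
inductive IsSimpleLoop : {i : F.Tile} → Quiver.Path i i → Prop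
  | mk (c : VertexColour) (e : F.Edge) :
      IsSimpleLoop ((F.arrow e).toPath.comp (F.brokenLoop c e))

/-- `e_i (ℂQ) e_j`: the part of the path algebra `ℂQ` spanned by the paths from `i` to `j`. -/
abbrev PathSpace (i j : F.Tile) : Type u := Quiver.Path i j →₀ ℂ

variable (F) in
/-- The F-term `∂W / ∂X_e` of the superpotential `W = ∑ (black cycles) - ∑ (white cycles)`.
The arrow `e` occurs exactly once in exactly one cycle of either colour, and rotating it to the
front of that cycle and deleting it leaves the corresponding broken loop. -/
noncomputable def fTerm (e : F.Edge) : PathSpace (F.head e) (F.tail e) :=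
  Finsupp.single (F.brokenLoop .black e) 1 - Finsupp.single (F.brokenLoop .white e) 1

/-- The part from `i` to `j` of the two-sided ideal of `ℂQ` generated by the F-terms. The quotient
of `ℂQ` by this ideal is the algebra `A_F`. -/
noncomputable def fTermIdeal (i j : F.Tile) : Submodule ℂ (PathSpace i j) :=
  Submodule.span ℂ {x | ∃ (e : F.Edge) (u : Quiver.Path i (F.head e))
    (v : Quiver.Path (F.tail e) j),
      x = (F.fTerm e).mapDomain (fun p => (u.comp p).comp v)}

/-- F-term equivalence `u ∼ v`: the two paths are equal in `A_F`. -/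
def FTermEquiv {i j : F.Tile} (u v : Quiver.Path i j) : Prop :=
  (Finsupp.single u 1 - Finsupp.single v 1 : PathSpace i j) ∈ fTermIdeal i j

/-- The `n`-fold repetition of a closed path. -/
def loopPow {j : F.Tile} (ω : Quiver.Path j j) : ℕ → Quiver.Path j j
  | 0 => Quiver.Path.nil
  | n + 1 => (loopPow ω n).comp ω

/-- Weak equivalence: `u ω_j ^ n ∼ v ω_j ^ n` for some `n ≥ 0` and a simple loop `ω_j`. -/
def WeaklyEquiv {i j : F.Tile} (u v : Quiver.Path i j) : Prop :=
  ∃ (ω : Quiver.Path j j) (n : ℕ), IsSimpleLoop ω ∧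
    FTermEquiv (u.comp (loopPow ω n)) (v.comp (loopPow ω n))

variable (F)

/-- A tiling is consistent if weak equivalence of paths implies F-term equivalence. -/
def Consistent : Prop :=
  ∀ (i j : F.Tile) (u v : Quiver.Path i j), WeaklyEquiv u v → FTermEquiv u v

/-- The element of the free groupoid on the dual quiver given by a path. -/
def freeClass {i j : F.Tile} (p : Quiver.Path i j) :
    (Quiver.FreeGroupoid.of F.Tile).obj i ⟶ (Quiver.FreeGroupoid.of F.Tile).obj j :=
  composePath ((Quiver.FreeGroupoid.of F.Tile).mapPath p)

/-- The relation making each revolution around a vertex of the tiling null-homotopic. -/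
inductive SimpleLoopRel : HomRel (Quiver.FreeGroupoid F.Tile)
  | mk {i : F.Tile} (p : Quiver.Path i i) (hp : IsSimpleLoop p) :
      SimpleLoopRel (F.freeClass p) (𝟙 _)

/-- The fundamental groupoid of the surface, with one object for each tile: morphisms are walks
along tiles that cross edges in either direction, modulo `e e⁻¹ = 1`, `e⁻¹ e = 1` and the boundary
of each 2-cell of the dual cell decomposition (that is, each revolution around a vertex of the
tiling). -/
abbrev FundGroupoid : Type u := CategoryTheory.Quotient F.SimpleLoopRel

/-- A tile as an object of the fundamental groupoid. -/
def fundObj (i : F.Tile) : F.FundGroupoid :=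
  (CategoryTheory.Quotient.functor F.SimpleLoopRel).obj ((Quiver.FreeGroupoid.of F.Tile).obj i)

variable {F} in
/-- The homotopy class of an arrow. -/
def fundClass {i j : F.Tile} (a : i ⟶ j) : F.fundObj i ⟶ F.fundObj j :=
  (CategoryTheory.Quotient.functor F.SimpleLoopRel).map ((Quiver.FreeGroupoid.of F.Tile).map a)

/-- The tiles of the lift of `F` to the universal cover of the surface, constructed from the base
tile `b`: pairs of a tile `j` of `F` and a homotopy class of walks from `b` to `j`. -/
def CoverTile (b : F.Tile) : Type u := Σ j : F.Tile, (F.fundObj b ⟶ F.fundObj j)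

/-- The lifted dual quiver: an arrow `a : j ⟶ k` of `Q` lifts to one arrow from each tile
`(j, γ)`, and this lift ends at `(k, γ a)`. -/
instance coverQuiver (b : F.Tile) : Quiver (F.CoverTile b) where
  Hom x y := {a : x.1 ⟶ y.1 // x.2 ≫ fundClass a = y.2}

/-- The projection from the lifted dual quiver to the dual quiver. -/
def coverProj (b : F.Tile) : F.CoverTile b ⥤q F.Tile where
  obj x := x.1
  map a := a.1

variable {F} {b : F.Tile}

/-- F-term equivalence of paths in the lifted tiling: they give the same element of `A_F`. -/
def CoverFTermEquiv {x y : F.CoverTile b} (u v : Quiver.Path x y) : Prop :=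
  FTermEquiv ((F.coverProj b).mapPath u) ((F.coverProj b).mapPath v)

/-- A simple loop in the lifted tiling. -/
def IsCoverSimpleLoop {x : F.CoverTile b} (ω : Quiver.Path x x) : Prop :=
  IsSimpleLoop ((F.coverProj b).mapPath ω)

/-- A path in the lifted tiling is minimal if it is not F-term equivalent to any path that contains
a simple loop. -/
def IsMinimalPath {x y : F.CoverTile b} (p : Quiver.Path x y) : Prop :=
  ¬ ∃ (z : F.CoverTile b) (u : Quiver.Path x z) (ω : Quiver.Path z z) (v : Quiver.Path z y),
    IsCoverSimpleLoop ω ∧ CoverFTermEquiv p ((u.comp ω).comp v)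

/-- The path `p` passes along the arrow `a`. -/
def PassesAlong {x y z w : F.CoverTile b} (p : Quiver.Path x y) (a : z ⟶ w) : Prop :=
  ∃ (u : Quiver.Path x z) (v : Quiver.Path w y), p = (u.comp a.toPath).comp v

variable (F)

/-- For any tiles `i, j` of the lifted tiling there is an arrow `a` from `j` to some tile `k` such
that some minimal path from `i` to `k` passes along `a`. -/
def MR2Out : Prop :=
  ∀ (b : F.Tile) (i j : F.CoverTile b), ∃ (k : F.CoverTile b) (a : j ⟶ k) (p : Quiver.Path i k),
    IsMinimalPath p ∧ PassesAlong p a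

/-- The dual: for any tiles `i, j` of the lifted tiling there is an arrow `a` from some tile `k` to
`j` such that some minimal path from `k` to `i` passes along `a`. -/
def MR2In : Prop :=
  ∀ (b : F.Tile) (i j : F.CoverTile b), ∃ (k : F.CoverTile b) (a : k ⟶ j) (p : Quiver.Path k i),
    IsMinimalPath p ∧ PassesAlong p a

/-- Condition MR2, including its dual. -/
def MR2 : Prop := F.MR2Out ∧ F.MR2In

end BraneTiling

/-! The argument runs in the universal cover, where equality in `A_F` becomes equivalence of lists
of arrows under moves that exchange the two broken loops of an arrow (`eqv_edges`, `eqv_of_map`).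
Simple loops commute with paths. Two lifted paths with the same ends are homotopic, so they agree
once suitable numbers of loops are appended (`weak_of_pathClass_eq`), and consistency allows common
loops to be cancelled.

Take a minimal path m from i to j (`exists_isMinimal`) and suppose that m a is not minimal for any
arrow a leaving j. Pushing the loop to the end and cancelling a shows that m is equivalent to a path
ending in the broken loop of a around either end of a (`exists_eqv_append_around`). Now turn about
the tile j. One move over a exchanges the black broken loop of a for the white one. The white broken
loop of a and the black broken loop of the next arrow out of j have the same last arrow b, so the
passage between them is an equivalence that leaves b alone. Paths equivalent to m visit j only at
their end (`tail_ne_of_isMinimal`), so this passage sweeps over no vertex of j (`exists_sweeps`).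

After a full turn the path is back where it began, so the 2-chain swept out has zero boundary. Its
coefficient at a vertex of j is nevertheless positive. This is impossible, because a finitely
supported 2-cycle vanishes when no component is finite (`flux_eq_zero_of_closed`).

The cover has no finite component because positive Euler-characteristic defect yields a closed
cochain that is not exact. It has a primitive on the cover, and maximising that primitive over the
lifts of each tile in a finite component would make the cochain exact
(`hasNoFiniteComponent_coverSystem`). The dual statement follows by reversing all arrows. -/

/-! ### Cycles of a permutation as lists. -/

section Around

theorem perm_apply_inv_apply {E : Type*} (σ : Equiv.Perm E) (e : E) : σ (σ⁻¹ e) = e :=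
  σ.apply_symm_apply e

variable {E E' : Type*}

/-- The remaining part `[σ e, σ² e, …]` of the cycle of `σ` through `e`. -/
noncomputable def around (σ : Equiv.Perm E) (e : E) : List E :=
  (List.range (Function.minimalPeriod σ e - 1)).map fun k => σ^[k + 1] e

theorem cons_around {σ : Equiv.Perm E} {e : E} (h : e ∈ Function.periodicPts σ) :
    e :: around σ e = (List.range (Function.minimalPeriod σ e)).map fun k => σ^[k] e := by
  have hpos := Function.minimalPeriod_pos_of_mem_periodicPts h
  obtain ⟨d, hd⟩ := Nat.exists_eq_add_of_lt hpos
  rw [around, hd, List.range_succ_eq_map]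
  simp [Function.comp_def]

theorem around_append_singleton {σ : Equiv.Perm E} {e : E} (h : e ∈ Function.periodicPts σ) :
    around σ e ++ [e] = σ e :: around σ (σ e) := by
  have hpos := Function.minimalPeriod_pos_of_mem_periodicPts h
  have hi : σ^[Function.minimalPeriod σ e] e = e := Function.iterate_minimalPeriod
  rw [around, around, Function.minimalPeriod_apply h]
  obtain ⟨d, hd⟩ := Nat.exists_eq_add_of_lt hpos
  rw [hd] at hi ⊢
  simp only [zero_add, Nat.add_sub_cancel] at hi ⊢
  have : (List.range d).map (fun k => σ^[k + 1] e) ++ [e]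
      = (List.range (d + 1)).map fun k => σ^[k + 1] e := by
    rw [List.range_succ, List.map_append, List.map_singleton, hi]
  rw [this, List.range_succ_eq_map]
  simp [Function.comp_def]

theorem inv_apply_mem_periodicPts {σ : Equiv.Perm E} {e : E} (h : e ∈ Function.periodicPts σ) :
    σ⁻¹ e ∈ Function.periodicPts σ := by
  obtain ⟨n, hn, hp⟩ := h
  refine ⟨n, hn, σ.injective ?_⟩
  rw [← Function.iterate_succ_apply' σ, Function.iterate_succ_apply, perm_apply_inv_apply]
  exact hp

theorem isPeriodicPt_perm_iff {σ : Equiv.Perm E} {n : ℕ} {e : E} :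
    Function.IsPeriodicPt σ n e ↔ (σ ^ n) e = e := by
  rw [Function.IsPeriodicPt, Function.IsFixedPt, ← Equiv.Perm.coe_pow]

theorem isPeriodicPt_inv_iff {σ : Equiv.Perm E} {n : ℕ} {e : E} :
    Function.IsPeriodicPt (σ⁻¹ : Equiv.Perm E) n e ↔ Function.IsPeriodicPt σ n e := by
  rw [isPeriodicPt_perm_iff, isPeriodicPt_perm_iff, inv_pow, Equiv.Perm.inv_eq_iff_eq, eq_comm]

theorem mem_periodicPts_inv {σ : Equiv.Perm E} {e : E} (h : e ∈ Function.periodicPts σ) :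
    e ∈ Function.periodicPts (σ⁻¹ : Equiv.Perm E) := by
  obtain ⟨n, hn, hp⟩ := h
  exact ⟨n, hn, isPeriodicPt_inv_iff.2 hp⟩

theorem minimalPeriod_inv (σ : Equiv.Perm E) (e : E) :
    Function.minimalPeriod (σ⁻¹ : Equiv.Perm E) e = Function.minimalPeriod σ e :=
  Function.minimalPeriod_eq_minimalPeriod_iff.2 fun _ => isPeriodicPt_inv_iff

theorem around_inv {σ : Equiv.Perm E} {e : E} (h : e ∈ Function.periodicPts σ) :
    around σ⁻¹ e = (around σ e).reverse := by
  have hpos := Function.minimalPeriod_pos_of_mem_periodicPts h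
  refine List.ext_getElem (by rw [List.length_reverse]; simp only [around, minimalPeriod_inv, List.length_map]) fun k hk hk' => ?_
  simp only [around, List.length_map, List.length_range, List.getElem_map, List.getElem_range,
    List.getElem_reverse, minimalPeriod_inv] at hk ⊢
  have hi : (σ ^ Function.minimalPeriod σ e) e = e :=
    isPeriodicPt_perm_iff.1 (Function.isPeriodicPt_minimalPeriod σ e)
  rw [← Equiv.Perm.coe_pow, ← Equiv.Perm.coe_pow, inv_pow, Equiv.Perm.inv_eq_iff_eq,
    ← Equiv.Perm.mul_apply, ← pow_add]
  conv_lhs => rw [← hi]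
  congr 2
  omega

/-- Without a fixed point the list is nonempty, and its last entry is the one that closes the cycle
at `e`. This entry is what the broken loops of neighbouring arrows out of a tile have in common. -/
theorem around_eq_append {σ : Equiv.Perm E} {e : E} (h : e ∈ Function.periodicPts σ)
    (hne : σ e ≠ e) : ∃ l, around σ e = l ++ [σ⁻¹ e] := by
  have h' := inv_apply_mem_periodicPts h
  have h1 := around_append_singleton h'
  rw [perm_apply_inv_apply] at h1
  rcases List.eq_nil_or_concat (around σ e) with h0 | ⟨l, x, hl⟩
  · exfalso
    rw [h0] at h1
    have h2 : around σ (σ⁻¹ e) = [] := by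
      have := congrArg List.length h1
      simp at this
      exact this
    rw [h2] at h1
    have h3 : σ⁻¹ e = e := by simpa using h1
    exact hne (Equiv.Perm.inv_eq_iff_eq.1 h3).symm
  · refine ⟨l, ?_⟩
    rw [List.concat_eq_append] at hl
    rw [hl, ← List.cons_append] at h1
    have := List.append_inj_right' h1 rfl
    rw [hl, this]

theorem around_ne_nil {σ : Equiv.Perm E} {e : E} (h : e ∈ Function.periodicPts σ)
    (hne : σ e ≠ e) : around σ e ≠ [] := by
  obtain ⟨l, hl⟩ := around_eq_append h hne
  simp [hl]

theorem mem_cons_around_iff {σ : Equiv.Perm E} {e f : E} (h : e ∈ Function.periodicPts σ) :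
    f ∈ e :: around σ e ↔ σ.SameCycle e f := by
  rw [cons_around h, ← Cycle.mem_coe_iff, ← Function.periodicOrbit_def,
    Function.mem_periodicOrbit_iff h]
  constructor
  · rintro ⟨n, rfl⟩
    exact ⟨n, by rw [zpow_natCast, Equiv.Perm.coe_pow]⟩
  · rintro ⟨z, rfl⟩
    have hd : (σ ^ (Function.minimalPeriod σ e : ℤ)) e = e := by
      rw [zpow_natCast]
      exact isPeriodicPt_perm_iff.1 (Function.isPeriodicPt_minimalPeriod σ e)
    have hpos : (0 : ℤ) < Function.minimalPeriod σ e := by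
      exact_mod_cast Function.minimalPeriod_pos_of_mem_periodicPts h
    -- Reducing modulo the period turns an integer exponent into a natural one.
    refine ⟨(z % Function.minimalPeriod σ e).toNat, ?_⟩
    have hz := Int.toNat_of_nonneg (Int.emod_nonneg z hpos.ne')
    rw [← Equiv.Perm.coe_pow, ← zpow_natCast, hz]
    conv_rhs => rw [← Int.emod_add_mul_ediv z (Function.minimalPeriod σ e), zpow_add, zpow_mul,
      Equiv.Perm.mul_apply, Equiv.Perm.zpow_apply_eq_self_of_apply_eq_self hd]

theorem nodup_cons_around {σ : Equiv.Perm E} {e : E} (h : e ∈ Function.periodicPts σ) :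
    (e :: around σ e).Nodup := by
  rw [cons_around h, ← Cycle.nodup_coe_iff, ← Function.periodicOrbit_def]
  exact Function.nodup_periodicOrbit

theorem mem_around {σ : Equiv.Perm E} {e f : E} (h : e ∈ Function.periodicPts σ)
    (hs : σ.SameCycle e f) (hne : f ≠ e) : f ∈ around σ e :=
  (List.mem_cons.1 ((mem_cons_around_iff h).2 hs)).resolve_left hne

open Classical in
theorem count_cons_around {σ : Equiv.Perm E} {e : E} (h : e ∈ Function.periodicPts σ) (f : E) :
    (e :: around σ e).count f = if σ.SameCycle e f then 1 else 0 := by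
  rw [(nodup_cons_around h).count]
  simp only [mem_cons_around_iff h]

theorem finite_setOf_sameCycle {σ : Equiv.Perm E} {e : E} (h : e ∈ Function.periodicPts σ) :
    {f | σ.SameCycle e f}.Finite :=
  (e :: around σ e).finite_toSet.subset fun _ hf => (mem_cons_around_iff h).2 hf

theorem map_around {σ : Equiv.Perm E} {τ : Equiv.Perm E'} {p : E → E'}
    (hp : Function.Semiconj p σ τ) {e : E}
    (hd : Function.minimalPeriod σ e = Function.minimalPeriod τ (p e)) :
    (around σ e).map p = around τ (p e) := by
  rw [around, around, List.map_map, hd]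
  refine List.map_congr_left fun k _ => ?_
  exact (hp.iterate_right (k + 1)) e

end Around

/-! ### Rotation systems: paths, moves and the centrality of loops. -/

/-- A set of arrows with end points, and for each colour a permutation with finite cycles sending
every arrow to one that starts where it ends. -/
structure RotationSystem (E T : Type*) where
  tail : E → T
  head : E → T
  next : VertexColour → Equiv.Perm E
  tail_next : ∀ c e, tail (next c e) = head e
  periodic : ∀ c e, e ∈ Function.periodicPts (next c)
  next_ne : ∀ c e, next c e ≠ e

namespace RotationSystem

variable {E T : Type*} (S : RotationSystem E T)

/-- `l` lists the arrows of a path from `i` to `j`. -/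
def IsPath : T → List E → T → Prop
  | i, [], j => i = j
  | i, e :: l, j => S.tail e = i ∧ IsPath (S.head e) l j

/-- Replacing a broken loop around the black end of an arrow by the one around its white end. -/
def Move (l l' : List E) : Prop :=
  ∃ u a v, l = u ++ around (S.next .black) a ++ v ∧ l' = u ++ around (S.next .white) a ++ v

/-- Equivalence of paths up to moves. -/
def Eqv : List E → List E → Prop := Relation.EqvGen S.Move

/-- A single revolution around a vertex, starting at `j`. -/
def IsLoop (j : T) (l : List E) : Prop :=
  ∃ c a, S.tail a = j ∧ l = a :: around (S.next c) a

variable {S}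

@[simp] theorem isPath_nil {i j : T} : S.IsPath i [] j ↔ i = j := Iff.rfl

@[simp] theorem isPath_cons {i j : T} {e : E} {l : List E} :
    S.IsPath i (e :: l) j ↔ S.tail e = i ∧ S.IsPath (S.head e) l j := Iff.rfl

theorem isPath_append {i j : T} {l l' : List E} :
    S.IsPath i (l ++ l') j ↔ ∃ k, S.IsPath i l k ∧ S.IsPath k l' j := by
  induction l generalizing i with
  | nil => simp
  | cons e l ih => simp [ih, and_assoc]

theorem IsPath.append {i j k : T} {l l' : List E} (h : S.IsPath i l k) (h' : S.IsPath k l' j) :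
    S.IsPath i (l ++ l') j := isPath_append.2 ⟨k, h, h'⟩

theorem IsPath.end_unique {i j j' : T} {l : List E} (h : S.IsPath i l j) (h' : S.IsPath i l j') :
    j = j' := by
  induction l generalizing i with
  | nil => exact h.symm.trans h'
  | cons e l ih => exact ih h.2 h'.2

theorem isPath_iterate (c : VertexColour) (e : E) (n : ℕ) :
    S.IsPath (S.head e) ((List.range n).map fun k => (S.next c)^[k + 1] e)
      (S.head ((S.next c)^[n] e)) := by
  induction n with
  | zero => simp
  | succ n ih =>
    rw [List.range_succ, List.map_append]
    refine ih.append ?_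
    simp only [List.map_singleton, isPath_cons, isPath_nil, and_true]
    rw [Function.iterate_succ_apply', S.tail_next]

theorem isPath_around (c : VertexColour) (e : E) :
    S.IsPath (S.head e) (around (S.next c) e) (S.tail e) := by
  have h := isPath_iterate (S := S) c e (Function.minimalPeriod (S.next c) e - 1)
  have hpos := Function.minimalPeriod_pos_of_mem_periodicPts (S.periodic c e)
  rwa [← S.tail_next c ((S.next c)^[_] e), ← Function.iterate_succ_apply' (S.next c),
    Nat.succ_eq_add_one, Nat.sub_add_cancel hpos, Function.iterate_minimalPeriod] at h

theorem IsLoop.isPath {j : T} {l : List E} (h : S.IsLoop j l) : S.IsPath j l j := by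
  obtain ⟨c, a, rfl, rfl⟩ := h
  exact ⟨rfl, isPath_around c a⟩

theorem isLoop_around_append (c : VertexColour) (a : E) :
    S.IsLoop (S.head a) (around (S.next c) a ++ [a]) :=
  ⟨c, S.next c a, S.tail_next c a, around_append_singleton (S.periodic c a)⟩

theorem around_next_ne_nil (c : VertexColour) (a : E) : around (S.next c) a ≠ [] :=
  around_ne_nil (S.periodic c a) (S.next_ne c a)

theorem IsLoop.ne_nil {j : T} {l : List E} (h : S.IsLoop j l) : l ≠ [] := by
  obtain ⟨c, a, rfl, rfl⟩ := h
  simp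

theorem Eqv.refl (l : List E) : S.Eqv l l := Relation.EqvGen.refl l

theorem Eqv.symm {l l' : List E} (h : S.Eqv l l') : S.Eqv l' l := Relation.EqvGen.symm _ _ h

theorem Eqv.trans {l l' l'' : List E} (h : S.Eqv l l') (h' : S.Eqv l' l'') : S.Eqv l l'' :=
  Relation.EqvGen.trans _ _ _ h h'

theorem eqv_around_aux (a : E) :
    S.Eqv (around (S.next .black) a) (around (S.next .white) a) :=
  Relation.EqvGen.rel _ _ ⟨[], a, [], by simp, by simp⟩

theorem eqv_around (c c' : VertexColour) (a : E) :
    S.Eqv (around (S.next c) a) (around (S.next c') a) := by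
  cases c <;> cases c' <;>
    first | exact Eqv.refl _ | exact eqv_around_aux a | exact (eqv_around_aux a).symm

theorem Eqv.append_both {l l' : List E} (h : S.Eqv l l') (u v : List E) :
    S.Eqv (u ++ l ++ v) (u ++ l' ++ v) := by
  induction h with
  | rel l l' h =>
    obtain ⟨u', a, v', rfl, rfl⟩ := h
    exact Relation.EqvGen.rel _ _ ⟨u ++ u', a, v' ++ v, by simp, by simp⟩
  | refl l => exact Eqv.refl _
  | symm _ _ _ ih => exact ih.symm
  | trans _ _ _ _ _ ih ih' => exact ih.trans ih'

theorem Eqv.append_left {l l' : List E} (u : List E) (h : S.Eqv l l') :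
    S.Eqv (u ++ l) (u ++ l') := by
  simpa using h.append_both u []

theorem Eqv.append_right {l l' : List E} (h : S.Eqv l l') (v : List E) :
    S.Eqv (l ++ v) (l' ++ v) := by
  simpa using h.append_both [] v

/-- The two broken loops of an arrow have the same ends, and a nonempty list determines the tile in
which it starts, so a move preserves both ends of a path. -/
theorem isPath_iff_of_eqv {l l' : List E} (h : S.Eqv l l') (i j : T) :
    S.IsPath i l j ↔ S.IsPath i l' j := by
  induction h generalizing i j with
  | rel l l' h =>
    have key : ∀ (c c' : VertexColour) (u v : List E) (a : E),
        S.IsPath i (u ++ around (S.next c) a ++ v) j →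
          S.IsPath i (u ++ around (S.next c') a ++ v) j := by
      intro c c' u v a h
      obtain ⟨k, hk, hv⟩ := isPath_append.1 h
      obtain ⟨k', hu, hk⟩ := isPath_append.1 hk
      have hk' : k' = S.head a := by
        have h1 := isPath_around (S := S) c a
        obtain ⟨e, l, hl⟩ := List.exists_cons_of_ne_nil (around_next_ne_nil (S := S) c a)
        rw [hl] at hk h1
        exact hk.1.symm.trans h1.1
      subst hk'
      obtain rfl := hk.end_unique (isPath_around c a)
      exact (hu.append (isPath_around c' a)).append hv
    obtain ⟨u, a, v, rfl, rfl⟩ := h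
    exact ⟨key _ _ u v a, key _ _ u v a⟩
  | refl l => rfl
  | symm _ _ _ ih => exact (ih i j).symm
  | trans _ _ _ _ _ ih ih' => exact (ih i j).trans (ih' i j)

theorem IsPath.of_eqv {i j : T} {l l' : List E} (hl : S.IsPath i l j) (h : S.Eqv l l') :
    S.IsPath i l' j := (isPath_iff_of_eqv h i j).1 hl

/-- Broken loops are nonempty because no vertex is univalent, so no move starts or ends at the empty
list. Arguments that cancel too many loops are refuted by this. -/
theorem eqv_nil_iff {l : List E} : S.Eqv [] l ↔ l = [] := by
  refine ⟨fun h => ?_, fun h => h ▸ Eqv.refl _⟩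
  have key : ∀ l l', S.Eqv l l' → (l = [] ↔ l' = []) := by
    intro l l' h
    induction h with
    | rel l l' h =>
      obtain ⟨u, a, v, rfl, rfl⟩ := h
      simp [around_next_ne_nil]
    | refl l => rfl
    | symm _ _ _ ih => exact ih.symm
    | trans _ _ _ _ _ ih ih' => exact ih.trans ih'
  exact (key _ _ h).1 rfl

variable (S) in
/-- All arrows leaving a tile lie in one cycle around it. -/
def IsPolygonal : Prop :=
  ∀ e f, S.tail e = S.tail f → (S.next .black * (S.next .white)⁻¹).SameCycle e f

theorem tail_sigma (e : E) :
    S.tail ((S.next .black * (S.next .white)⁻¹) e) = S.tail e := by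
  rw [Equiv.Perm.mul_apply, S.tail_next, ← S.tail_next .white, perm_apply_inv_apply]

/-- Let `f` be the arrow before `e` around its white end. The white loop at `e` and the black loop
at the next arrow out of the tile are the two broken loops of `f` followed by `f`, so they differ by
the move over `f`. -/
theorem eqv_loop_sigma (c c' : VertexColour) (e : E) :
    S.Eqv (e :: around (S.next c) e) ((S.next .black * (S.next .white)⁻¹) e ::
      around (S.next c') ((S.next .black * (S.next .white)⁻¹) e)) := by
  set f := (S.next .white)⁻¹ e with hf
  have hfe : S.next .white f = e := perm_apply_inv_apply _ e
  have h1 : S.Eqv (e :: around (S.next c) e) (e :: around (S.next .white) e) :=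
    (eqv_around c .white e).append_left [e]
  have h2 : e :: around (S.next .white) e = around (S.next .white) f ++ [f] := by
    rw [around_append_singleton (S.periodic _ f), hfe]
  have h3 := around_append_singleton (S.periodic .black f)
  rw [Equiv.Perm.mul_apply]
  refine h1.trans ?_
  rw [h2]
  refine ((eqv_around .white .black f).append_right [f]).trans ?_
  rw [h3]
  exact (eqv_around .black c' (S.next .black f)).append_left [S.next .black f]

theorem IsLoop.eqv (hS : S.IsPolygonal) {j : T} {l l' : List E} (h : S.IsLoop j l)
    (h' : S.IsLoop j l') : S.Eqv l l' := by
  obtain ⟨c, e, rfl, rfl⟩ := h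
  obtain ⟨c', f, hf, rfl⟩ := h'
  have key : ∀ (n : ℕ) (e : E), S.Eqv (e :: around (S.next c) e)
      (((S.next .black * (S.next .white)⁻¹) ^ n) e ::
        around (S.next c) (((S.next .black * (S.next .white)⁻¹) ^ n) e)) := by
    intro n
    induction n with
    | zero => exact fun e => Eqv.refl _
    | succ n ih =>
      intro e
      rw [pow_succ', Equiv.Perm.mul_apply]
      exact (ih e).trans (eqv_loop_sigma c c _)
  have hc : S.Eqv (f :: around (S.next c) f) (f :: around (S.next c') f) :=
    (eqv_around c c' f).append_left [f]
  refine Eqv.trans ?_ hc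
  obtain ⟨z, hz⟩ := hS e f hf.symm
  obtain ⟨n, rfl | rfl⟩ := z.eq_nat_or_neg
  · rw [zpow_natCast] at hz
    subst hz
    exact key n e
  · rw [zpow_neg, zpow_natCast, Equiv.Perm.inv_eq_iff_eq] at hz
    subst hz
    exact (key n f).symm

/-- The loop before an arrow `e` may be taken to be `e` followed by its broken loop. Followed by
`e`, this rebrackets as `e` and then a loop at the head of `e`, so loops slide along a path one
arrow at a time. -/
theorem IsLoop.eqv_append_comm (hS : S.IsPolygonal) {i j : T} {ω ω' u : List E}
    (hω : S.IsLoop i ω) (hω' : S.IsLoop j ω') (hu : S.IsPath i u j) :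
    S.Eqv (ω ++ u) (u ++ ω') := by
  induction u generalizing i ω with
  | nil =>
    obtain rfl : i = j := hu
    simpa using hω.eqv hS hω'
  | cons e u ih =>
    obtain ⟨rfl, hu⟩ := hu
    have h1 : S.Eqv ω (e :: around (S.next .black) e) := hω.eqv hS ⟨_, e, rfl, rfl⟩
    have h2 := ih (isLoop_around_append .black e) hu
    refine (h1.append_right (e :: u)).trans ?_
    simpa using h2.append_left [e]

/-- The `n`-fold repetition of a list. -/
def rep (ω : List E) : ℕ → List E
  | 0 => []
  | n + 1 => ω ++ rep ω n

@[simp] theorem rep_zero (ω : List E) : rep ω 0 = [] := rfl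

theorem rep_succ (ω : List E) (n : ℕ) : rep ω (n + 1) = ω ++ rep ω n := rfl

theorem rep_add (ω : List E) (m n : ℕ) : rep ω (m + n) = rep ω m ++ rep ω n := by
  induction m with
  | zero => simp
  | succ m ih => rw [Nat.add_right_comm, rep_succ, rep_succ, ih, List.append_assoc]

theorem rep_succ' (ω : List E) (n : ℕ) : rep ω (n + 1) = rep ω n ++ ω := by
  rw [rep_add]
  simp [rep]

theorem isPath_rep {j : T} {ω : List E} (h : S.IsPath j ω j) (n : ℕ) : S.IsPath j (rep ω n) j := by
  induction n with
  | zero => rfl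
  | succ n ih => exact h.append ih

theorem eqv_rep_append_comm (hS : S.IsPolygonal) {i j : T} {ω ω' u : List E}
    (hω : S.IsLoop i ω) (hω' : S.IsLoop j ω') (hu : S.IsPath i u j) (n : ℕ) :
    S.Eqv (rep ω n ++ u) (u ++ rep ω' n) := by
  induction n with
  | zero => simpa using Eqv.refl u
  | succ n ih =>
    rw [rep_succ, rep_succ', List.append_assoc]
    refine (ih.append_left ω).trans ?_
    rw [← List.append_assoc, ← List.append_assoc]
    refine ((hω.eqv_append_comm hS hω' hu).append_right _).trans ?_
    rw [List.append_assoc, List.append_assoc, ← rep_succ, ← rep_succ']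
    exact Eqv.refl _

theorem eqv_rep (hS : S.IsPolygonal) {j : T} {ω ω' : List E} (hω : S.IsLoop j ω)
    (hω' : S.IsLoop j ω') (n : ℕ) : S.Eqv (rep ω n) (rep ω' n) := by
  simpa using eqv_rep_append_comm hS hω hω' (u := []) rfl n

end RotationSystem

/-! ### The 2-chains swept out by equivalences. -/

namespace RotationSystem

variable {E T : Type*} {S : RotationSystem E T}

section Flux

open Classical in
/-- The total coefficient of the 2-chain `x` on the vertex of colour `c` of the arrow `e`. -/
noncomputable def flux (S : RotationSystem E T) (c : VertexColour) (e : E) : (E →₀ ℤ) →+ ℤ :=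
  Finsupp.liftAddHom fun a => if (S.next c).SameCycle a e then AddMonoidHom.id ℤ else 0

open Classical in
theorem flux_single (c : VertexColour) (e a : E) (n : ℤ) :
    S.flux c e (Finsupp.single a n) = if (S.next c).SameCycle a e then n else 0 := by
  rw [flux, Finsupp.liftAddHom_apply_single]
  split_ifs <;> rfl

theorem flux_eq_zero {c : VertexColour} {e : E} {x : E →₀ ℤ}
    (h : ∀ a ∈ x.support, ¬ (S.next c).SameCycle a e) : S.flux c e x = 0 := by
  rw [flux, Finsupp.liftAddHom_apply, Finsupp.sum]
  refine Finset.sum_eq_zero fun a ha => ?_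
  rw [if_neg (h a ha)]
  rfl

open Classical in
theorem flux_next (c : VertexColour) (e : E) (x : E →₀ ℤ) :
    S.flux c (S.next c e) x = S.flux c e x := by
  rw [flux, flux]
  congr 2
  exact funext fun a => if_congr Equiv.Perm.sameCycle_apply_right rfl rfl

open Classical in
/-- The 1-chain of `l'` minus that of `l` is the boundary of the 2-chain `x`, in which every move
over an arrow counts once for each end of that arrow. -/
def Sweeps (S : RotationSystem E T) (x : E →₀ ℤ) (l l' : List E) : Prop :=
  ∀ e, (l'.count e : ℤ) - l.count e = S.flux .white e x - S.flux .black e x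

theorem Sweeps.refl (l : List E) : S.Sweeps 0 l l := fun e => by simp

theorem Sweeps.symm {x : E →₀ ℤ} {l l' : List E} (h : S.Sweeps x l l') : S.Sweeps (-x) l' l :=
  fun e => by
    have := h e
    rw [map_neg, map_neg]
    linarith

theorem Sweeps.trans {x y : E →₀ ℤ} {l l' l'' : List E} (h : S.Sweeps x l l')
    (h' : S.Sweeps y l' l'') : S.Sweeps (x + y) l l'' := fun e => by
  have := h e
  have := h' e
  rw [map_add, map_add]
  linarith

theorem Sweeps.append_right {x : E →₀ ℤ} {l l' : List E} (h : S.Sweeps x l l') (v : List E) :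
    S.Sweeps x (l ++ v) (l' ++ v) := fun e => by
  have := h e
  simp only [List.count_append, Nat.cast_add]
  linarith

/-- Completing each broken loop by `a` does not change the difference of the counts, and a completed
loop contains each edge of its vertex exactly once. -/
theorem sweeps_around (u v : List E) (a : E) :
    S.Sweeps (Finsupp.single a 1) (u ++ around (S.next .black) a ++ v)
      (u ++ around (S.next .white) a ++ v) := fun e => by
  classical
  have hB := count_cons_around (S.periodic .black a) e
  have hW := count_cons_around (S.periodic .white a) e
  rw [List.count_cons] at hB hW
  rw [flux_single, flux_single]
  simp only [List.count_append, Nat.cast_add]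
  zify at hB hW
  convert_to ((around (S.next .white) a).count e : ℤ) - (around (S.next .black) a).count e = _
  · ring
  · convert_to _ = ((if (S.next .white).SameCycle a e then 1 else 0 : ℤ)) -
      (if (S.next .black).SameCycle a e then 1 else 0 : ℤ)
    linarith

variable (S) in
/-- There is no nonempty finite set of arrows that is a union of connected components. -/
def HasNoFiniteComponent : Prop :=
  ∀ A : Set E, A.Finite → (∀ c, ∀ e ∈ A, S.next c e ∈ A) → A = ∅

/-- Zero boundary means that the black and white fluxes agree at every edge. The edges of nonzero
flux are then stable under both rotations, and they are finite in number because the chain has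
finite support and the cycles are finite. -/
theorem flux_eq_zero_of_closed (hS : S.HasNoFiniteComponent) {x : E →₀ ℤ} {l : List E}
    (h : S.Sweeps x l l) (e : E) : S.flux .black e x = 0 := by
  have heq : ∀ e, S.flux .black e x = S.flux .white e x := fun e => by
    have := h e
    linarith
  have hA : {e | S.flux .black e x ≠ 0} = ∅ := by
    refine hS _ ?_ ?_
    · refine (x.support.finite_toSet.biUnion fun a _ =>
        finite_setOf_sameCycle (S.periodic .black a)).subset fun e he => ?_
      by_contra hne
      refine he (flux_eq_zero fun a ha hs => hne ?_)
      exact Set.mem_biUnion ha hs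
    · rintro (_ | _) e he
      · rwa [Set.mem_ofPred, flux_next]
      · rwa [Set.mem_ofPred, heq, flux_next, ← heq]
  by_contra hne
  exact (Set.mem_empty_iff_false e).1 (hA ▸ hne)

end Flux

/-! ### Minimal paths in the lift of a consistent tiling. -/

variable (S) in
/-- The properties of the lift of a consistent tiling to the universal cover of a surface of
positive genus. -/
structure IsConsistentPlane : Prop where
  isPolygonal : S.IsPolygonal
  exists_tail_eq : ∀ j, ∃ a, S.tail a = j
  finite_tail_eq : ∀ j, {a | S.tail a = j}.Finite
  cancel : ∀ {i j u v ω}, S.IsPath i u j → S.IsPath i v j → S.IsLoop j ω →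
    S.Eqv (u ++ ω) (v ++ ω) → S.Eqv u v
  exists_rep : ∀ {i j u v ω}, S.IsPath i u j → S.IsPath i v j → S.IsLoop j ω →
    ∃ m n, S.Eqv (u ++ rep ω m) (v ++ rep ω n)
  exists_isPath : ∀ i j, ∃ l, S.IsPath i l j
  hasNoFiniteComponent : S.HasNoFiniteComponent

variable (S) in
/-- The path `p` is not equivalent to any path containing a loop around a vertex. -/
def IsMinimal (p : List E) : Prop :=
  ¬ ∃ j u ω v, S.IsLoop j ω ∧ S.Eqv p (u ++ ω ++ v)

namespace IsConsistentPlane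

variable (hS : S.IsConsistentPlane)
include hS

theorem cancel_rep {i j : T} {u v ω : List E} (hu : S.IsPath i u j) (hv : S.IsPath i v j)
    (hω : S.IsLoop j ω) {n : ℕ} (h : S.Eqv (u ++ rep ω n) (v ++ rep ω n)) : S.Eqv u v := by
  induction n with
  | zero => simpa using h
  | succ n ih =>
    rw [rep_succ', ← List.append_assoc, ← List.append_assoc] at h
    exact ih (hS.cancel (hu.append (isPath_rep hω.isPath n)) (hv.append (isPath_rep hω.isPath n))
      hω h)

/-- Completing the last arrow to a loop reduces its cancellation to that of the loop. -/
theorem cancel_singleton {i j : T} {u v : List E} {b : E} (hu : S.IsPath i (u ++ [b]) j)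
    (hv : S.IsPath i (v ++ [b]) j) (h : S.Eqv (u ++ [b]) (v ++ [b])) : S.Eqv u v := by
  obtain ⟨k, hu, rfl, -⟩ := isPath_append.1 hu
  obtain ⟨k', hv, rfl, -⟩ := isPath_append.1 hv
  refine hS.cancel hu hv ⟨.black, b, rfl, rfl⟩ ?_
  simpa using h.append_right (around (S.next .black) b)

theorem exists_isLoop (j : T) : ∃ ω, S.IsLoop j ω := by
  obtain ⟨a, ha⟩ := hS.exists_tail_eq j
  exact ⟨_, .black, a, ha, rfl⟩

/-- Compare `v` with the empty path and cancel the common loops. If the surplus loops fall on the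
side of `v`, then `v` followed by them is equivalent to the empty path, which forces `v` to be
empty. -/
theorem exists_eqv_rep {j : T} {v ω : List E} (hv : S.IsPath j v j) (hω : S.IsLoop j ω) :
    ∃ n, S.Eqv v (rep ω n) := by
  obtain ⟨m, n, h⟩ := hS.exists_rep hv (v := []) rfl hω
  rw [List.nil_append] at h
  rcases le_total m n with hmn | hmn
  · obtain ⟨k, rfl⟩ := Nat.exists_eq_add_of_le' hmn
    rw [rep_add] at h
    exact ⟨k, hS.cancel_rep hv (isPath_rep hω.isPath k) hω h⟩
  · obtain ⟨k, rfl⟩ := Nat.exists_eq_add_of_le' hmn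
    rw [rep_add, ← List.append_assoc] at h
    have h1 : S.Eqv (v ++ rep ω k) [] := hS.cancel_rep
      (hv.append (isPath_rep hω.isPath k)) (v := []) rfl hω h
    have h2 := eqv_nil_iff.1 h1.symm
    exact ⟨0, by rw [(List.append_eq_nil_iff.1 h2).1]; exact Eqv.refl _⟩

/-- A path that returns to its starting tile contains a loop up to equivalence. -/
theorem exists_eqv_loop_append {j : T} {v ω : List E} (hv : S.IsPath j v j) (hne : v ≠ [])
    (hω : S.IsLoop j ω) : ∃ w, S.Eqv v (ω ++ w) := by
  obtain ⟨n, hn⟩ := hS.exists_eqv_rep hv hω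
  cases n with
  | zero => exact absurd (eqv_nil_iff.1 hn.symm) hne
  | succ n => exact ⟨_, hn⟩

/-- If no path were minimal, arbitrarily many loops could be split off from `p`. However, `p`
followed by a return path `r` is equivalent to a fixed power of a loop. -/
theorem exists_isMinimal (i j : T) : ∃ p, S.IsPath i p j ∧ S.IsMinimal p := by
  obtain ⟨p, hp⟩ := hS.exists_isPath i j
  obtain ⟨r, hr⟩ := hS.exists_isPath j i
  obtain ⟨ω, hω⟩ := hS.exists_isLoop i
  obtain ⟨ω', hω'⟩ := hS.exists_isLoop j
  obtain ⟨k, hk⟩ := hS.exists_eqv_rep (hp.append hr) hω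
  by_contra! hcon
  have key : ∀ n, ∃ q, S.IsPath i q j ∧ S.Eqv p (q ++ rep ω' n) := by
    intro n
    induction n with
    | zero => exact ⟨p, hp, by simpa using Eqv.refl p⟩
    | succ n ih =>
      obtain ⟨q, hq, hpq⟩ := ih
      have hmin := hcon q hq
      simp only [IsMinimal, not_not] at hmin
      obtain ⟨z, u, o, v, ho, h⟩ := hmin
      have hpath := hq.of_eqv h
      obtain ⟨z2, hz2, hv⟩ := isPath_append.1 hpath
      obtain ⟨z1, hu, ho'⟩ := isPath_append.1 hz2
      have hz1 : z1 = z := by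
        obtain ⟨c, a, rfl, rfl⟩ := ho
        exact ho'.1.symm
      subst hz1
      obtain rfl := ho.isPath.end_unique ho'
      refine ⟨u ++ v, hu.append hv, hpq.trans ?_⟩
      have h1 : S.Eqv q (u ++ v ++ ω') := by
        refine h.trans ?_
        simpa using (ho.eqv_append_comm hS.isPolygonal hω' hv).append_left u
      rw [rep_succ, ← List.append_assoc]
      exact h1.append_right _
  -- One more loop than the closed path `p ++ r` holds: cancelling `k` of them leaves a nonempty
  -- path equivalent to the empty one.
  obtain ⟨q, hq, hpq⟩ := key (k + 1)
  have h1 : S.Eqv (p ++ r) (q ++ r ++ rep ω (k + 1)) := by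
    refine (hpq.append_right r).trans ?_
    simpa using (eqv_rep_append_comm hS.isPolygonal hω' hω hr (k + 1)).append_left q
  have h2 : S.Eqv (q ++ r ++ ω) [] := by
    refine hS.cancel_rep ((hq.append hr).append hω.isPath) (v := []) rfl hω (n := k) ?_
    rw [List.append_assoc, ← rep_succ]
    exact h1.symm.trans hk
  exact hω.ne_nil (List.append_eq_nil_iff.1 (eqv_nil_iff.1 h2.symm)).2

/-- If `m a` is not minimal then `m` is equivalent to a path ending with the broken loops
of `a`. -/
theorem exists_eqv_append_around {i : T} {m : List E} {a : E} (hm : S.IsPath i m (S.tail a))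
    (h : ¬ S.IsMinimal (m ++ [a])) (c : VertexColour) :
    ∃ s, S.Eqv m (s ++ around (S.next c) a) := by
  simp only [IsMinimal, not_not] at h
  obtain ⟨z, u, o, v, ho, h⟩ := h
  have hma : S.IsPath i (m ++ [a]) (S.head a) := hm.append ⟨rfl, rfl⟩
  have hpath := hma.of_eqv h
  obtain ⟨z2, hz2, hv⟩ := isPath_append.1 hpath
  obtain ⟨z1, hu, ho'⟩ := isPath_append.1 hz2
  have hz1 : z1 = z := by
    obtain ⟨c, a, rfl, rfl⟩ := ho
    exact ho'.1.symm
  subst hz1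
  obtain rfl := ho.isPath.end_unique ho'
  refine ⟨u ++ v, ?_⟩
  -- The loop slides past `v` to the end, where it may be chosen to finish with `a`, so that `a` can
  -- be cancelled.
  have h1 : S.Eqv (m ++ [a]) (u ++ v ++ around (S.next c) a ++ [a]) := by
    refine h.trans ?_
    simpa using (ho.eqv_append_comm hS.isPolygonal (isLoop_around_append c a) hv).append_left u
  have h2 := (hu.append hv).append (isPath_around c a)
  exact hS.cancel_singleton hma (h2.append ⟨rfl, rfl⟩) h1

/-- From an earlier visit to `j` onwards the path would be closed and nonempty, so up to equivalence
it would contain a loop. -/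
theorem tail_ne_of_isMinimal {i j : T} {m q : List E} (hm : S.IsPath i m j) (hmin : S.IsMinimal m)
    (h : S.Eqv m q) {e : E} (he : e ∈ q) : S.tail e ≠ j := by
  rintro rfl
  obtain ⟨u, v, rfl⟩ := List.append_of_mem he
  obtain ⟨k, hu, hv⟩ := isPath_append.1 (hm.of_eqv h)
  obtain rfl := hv.1
  obtain ⟨ω, hω⟩ := hS.exists_isLoop (S.tail e)
  obtain ⟨w, hw⟩ := hS.exists_eqv_loop_append hv (by simp) hω
  refine hmin ⟨_, u, ω, w, hω, h.trans ?_⟩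
  simpa using hw.append_left u

/-- The equivalence of two paths to `j` with the same last arrow sweeps over no vertex of the
tile `j`. -/
theorem exists_sweeps {i j : T} {m : List E} (hm : S.IsPath i m j) (hmin : S.IsMinimal m) {b : E}
    {r r' : List E} (h : S.Eqv r r') (hr : S.Eqv m (r ++ [b])) :
    ∃ x, S.Sweeps x r r' ∧
      ∀ c, ∀ a ∈ x.support, ∀ e, S.tail e = j → ¬ (S.next c).SameCycle a e := by
  induction h with
  | rel r r' h =>
    obtain ⟨u, a, v, rfl, rfl⟩ := h
    refine ⟨Finsupp.single a 1, sweeps_around u v a, fun c a' ha' e he hs => ?_⟩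
    obtain rfl : a' = a := by
      simpa using Finsupp.support_single_subset ha'
    have hc : S.Eqv m (u ++ around (S.next c) a' ++ v ++ [b]) :=
      hr.trans ((((eqv_around .black c a').append_left u).append_right v).append_right [b])
    have hF := @tail_ne_of_isMinimal _ _ _ hS _ _ _ _ hm hmin hc
    -- The arrow `a'` is not in its own broken loop, so this case needs another witness: the path
    -- continues after the broken loop from the tail of `a'`, because the final `b` makes `v ++ [b]`
    -- nonempty.
    by_cases hea : e = a'
    · subst hea
      obtain ⟨f, w, hf⟩ : ∃ f w, v ++ [b] = f :: w :=
        List.exists_cons_of_ne_nil (by simp)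
      rw [List.append_assoc, hf] at hc hF
      obtain ⟨k, hk, hk'⟩ := isPath_append.1 (hm.of_eqv hc)
      obtain ⟨k', -, hk2⟩ := isPath_append.1 hk
      obtain ⟨f', w', hf'⟩ := List.exists_cons_of_ne_nil (around_next_ne_nil (S := S) c e)
      have h1 := isPath_around (S := S) c e
      have : k = S.tail e := by
        rw [hf'] at h1 hk2
        exact hk2.2.end_unique h1.2
      exact hF (e := f) (by simp) (hk'.1.trans (this.trans he))
    · exact hF (e := e) (by simp [mem_around (S.periodic c a') hs hea]) he
  | refl r => exact ⟨0, Sweeps.refl r, by simp⟩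
  | symm r r' h ih =>
    obtain ⟨x, hx, hx'⟩ := ih (hr.trans ((Eqv.symm h).append_right [b]))
    exact ⟨-x, hx.symm, by simpa using hx'⟩
  | trans r r' r'' h h' ih ih' =>
    classical
    obtain ⟨x, hx, hx'⟩ := ih hr
    obtain ⟨y, hy, hy'⟩ := ih' (hr.trans (Eqv.append_right h [b]))
    refine ⟨x + y, hx.trans hy, fun c a ha => ?_⟩
    rcases Finset.mem_union.1 (Finsupp.support_add ha) with ha | ha
    exacts [hx' c a ha, hy' c a ha]

theorem exists_isMinimal_append (i j : T) :
    ∃ a m, S.tail a = j ∧ S.IsPath i m j ∧ S.IsMinimal (m ++ [a]) := by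
  classical
  by_contra! hcon
  obtain ⟨m, hm, hmin⟩ := hS.exists_isMinimal i j
  have hs : ∀ a, ∃ s, S.tail a = j → S.Eqv m (s ++ around (S.next .black) a) := fun a => by
    by_cases ha : S.tail a = j
    · obtain ⟨s, hs⟩ := hS.exists_eqv_append_around (c := .black) (ha ▸ hm) (hcon a m ha hm)
      exact ⟨s, fun _ => hs⟩
    · exact ⟨[], fun h => absurd h ha⟩
  choose s hs using hs
  set σ := S.next .black * (S.next .white)⁻¹ with hσ
  have hstep : ∀ a, S.tail a = j → ∃ x, S.Sweeps x (s a ++ around (S.next .white) a)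
      (s (σ a) ++ around (S.next .black) (σ a)) ∧
      ∀ c, ∀ a ∈ x.support, ∀ e, S.tail e = j → ¬ (S.next c).SameCycle a e := by
    intro a ha
    have hσa : S.tail (σ a) = j := (tail_sigma a).trans ha
    obtain ⟨l, hl⟩ := around_eq_append (S.periodic .white a) (S.next_ne .white a)
    obtain ⟨l', hl'⟩ := around_eq_append (S.periodic .black (σ a)) (S.next_ne .black (σ a))
    -- The common last arrow of the two broken loops, entering `j` between `a` and `σ a`.
    have hb : (S.next .black)⁻¹ (σ a) = (S.next .white)⁻¹ a := by
      rw [hσ, Equiv.Perm.mul_apply]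
      exact (S.next .black).symm_apply_apply _
    have h1 := (hs a ha).trans ((eqv_around .black .white a).append_left (s a))
    have h2 := hs (σ a) hσa
    rw [hl, ← List.append_assoc] at h1
    rw [hl', hb, ← List.append_assoc] at h2
    have h3 : S.Eqv (s a ++ l) (s (σ a) ++ l') :=
      hS.cancel_singleton (hm.of_eqv h1) (hm.of_eqv h2) (h1.symm.trans h2)
    obtain ⟨x, hx, hx'⟩ := hS.exists_sweeps hm hmin h3 h1
    refine ⟨x, ?_, hx'⟩
    rw [hl, hl', hb, ← List.append_assoc, ← List.append_assoc]
    exact hx.append_right _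
  obtain ⟨a₀, ha₀⟩ := hS.exists_tail_eq j
  have htail : ∀ t : ℕ, S.tail ((σ ^ t) a₀) = j := fun t => by
    induction t with
    | zero => exact ha₀
    | succ t ih => rw [pow_succ', Equiv.Perm.mul_apply]; exact (tail_sigma _).trans ih
  -- Only the moves over the arrows `σ ^ t a₀` affect the flux at the black end of `a₀`. Each
  -- contributes 0 or 1, and the first, over `a₀` itself, contributes 1.
  have hrot : ∀ t : ℕ, ∃ x, S.Sweeps x (s a₀ ++ around (S.next .black) a₀)
      (s ((σ ^ t) a₀) ++ around (S.next .black) ((σ ^ t) a₀)) ∧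
      0 ≤ S.flux .black a₀ x ∧ (t ≠ 0 → 0 < S.flux .black a₀ x) := by
    intro t
    induction t with
    | zero => exact ⟨0, Sweeps.refl _, by simp⟩
    | succ t ih =>
      obtain ⟨x, hx, hx0, hx1⟩ := ih
      obtain ⟨y, hy, hy0⟩ := hstep _ (htail t)
      have hz := sweeps_around (S := S) (s ((σ ^ t) a₀)) [] ((σ ^ t) a₀)
      rw [List.append_nil, List.append_nil] at hz
      rw [pow_succ', Equiv.Perm.mul_apply]
      have hzero : S.flux .black a₀ y = 0 := flux_eq_zero fun a ha => hy0 .black a ha a₀ ha₀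
      refine ⟨_, (hx.trans hz).trans hy, ?_⟩
      rw [map_add, map_add, hzero, add_zero, flux_single]
      rcases eq_or_ne t 0 with rfl | ht
      · simp only [pow_zero, Equiv.Perm.one_apply, Equiv.Perm.SameCycle.refl, if_true]
        constructor <;> intros <;> linarith
      · have := hx1 ht
        split_ifs <;> constructor <;> intros <;> linarith
  -- A full turn about `j` exists because only finitely many arrows leave `j`.
  obtain ⟨t, ht, hfix⟩ : ∃ t : ℕ, t ≠ 0 ∧ (σ ^ t) a₀ = a₀ := by
    have hmaps : ∀ t ∈ (Set.univ : Set ℕ), (σ ^ t) a₀ ∈ {a | S.tail a = j} := fun t _ => htail t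
    obtain ⟨p, -, q, -, hpq, h⟩ :=
      Set.infinite_univ.exists_lt_map_eq_of_mapsTo hmaps (hS.finite_tail_eq j)
    refine ⟨q - p, by omega, (σ ^ p).injective ?_⟩
    rw [← Equiv.Perm.mul_apply, ← pow_add, Nat.add_sub_cancel' hpq.le, h]
  obtain ⟨x, hx, -, hpos⟩ := hrot t
  rw [hfix] at hx
  exact (hpos ht).ne' (flux_eq_zero_of_closed hS.hasNoFiniteComponent hx a₀)

end IsConsistentPlane

end RotationSystem

/-! ### Reversal of all arrows. -/

namespace RotationSystem

variable {E T : Type*} {S : RotationSystem E T}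

variable (S) in
/-- The rotation system with all arrows reversed. -/
def op : RotationSystem E T where
  tail := S.head
  head := S.tail
  next c := (S.next c)⁻¹
  tail_next c e := by rw [← S.tail_next c, perm_apply_inv_apply]
  periodic c e := mem_periodicPts_inv (S.periodic c e)
  next_ne c e h := S.next_ne c e (Equiv.Perm.inv_eq_iff_eq.1 h).symm

@[simp] theorem op_op : S.op.op = S := rfl

theorem around_op (c : VertexColour) (a : E) :
    around (S.op.next c) a = (around (S.next c) a).reverse := around_inv (S.periodic c a)

theorem IsPath.op {i j : T} {l : List E} (h : S.IsPath i l j) : S.op.IsPath j l.reverse i := by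
  induction l generalizing i with
  | nil => exact Eq.symm h
  | cons e l ih =>
    rw [List.reverse_cons]
    exact (ih h.2).append ⟨rfl, h.1⟩

theorem Eqv.op {l l' : List E} (h : S.Eqv l l') : S.op.Eqv l.reverse l'.reverse := by
  induction h with
  | rel l l' h =>
    obtain ⟨u, a, v, rfl, rfl⟩ := h
    exact Relation.EqvGen.rel _ _ ⟨v.reverse, a, u.reverse, by simp [around_op], by simp [around_op]⟩
  | refl l => exact Eqv.refl _
  | symm _ _ _ ih => exact ih.symm
  | trans _ _ _ _ _ ih ih' => exact ih.trans ih'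

theorem IsLoop.op {j : T} {ω : List E} (h : S.IsLoop j ω) : S.op.IsLoop j ω.reverse := by
  obtain ⟨c, a, rfl, rfl⟩ := h
  rw [List.reverse_cons, ← around_op]
  exact isLoop_around_append (S := S.op) c a

theorem reverse_rep (ω : List E) (n : ℕ) : (rep ω n).reverse = rep ω.reverse n := by
  induction n with
  | zero => rfl
  | succ n ih => rw [rep_succ, rep_succ', List.reverse_append, ih]

theorem IsMinimal.op {p : List E} (h : S.IsMinimal p) : S.op.IsMinimal p.reverse := by
  rintro ⟨j, u, ω, v, hω, hp⟩
  exact h ⟨j, v.reverse, ω.reverse, u.reverse, hω.op, by simpa using hp.op⟩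

/-- Conjugation by the black rotation turns the cyclic order of the arrows leaving a tile into the
inverse of the one for the reversed system, which permutes the arrows entering it. -/
theorem IsPolygonal.op (hS : S.IsPolygonal) : S.op.IsPolygonal := by
  intro e f h
  have h1 := hS (S.next .black e) (S.next .black f)
    (by rw [S.tail_next, S.tail_next]; exact h)
  have h2 := h1.conj (g := (S.next .black)⁻¹)
  have h3 : ∀ e, (S.next .black)⁻¹ (S.next .black e) = e :=
    fun e => (S.next .black).symm_apply_apply e
  rw [h3, h3, inv_inv] at h2
  have h4 : (S.next .black)⁻¹ * (S.next .black * (S.next .white)⁻¹) * S.next .black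
      = (S.op.next .black * (S.op.next .white)⁻¹)⁻¹ := by
    simp only [RotationSystem.op, inv_inv]
    group
  rw [h4] at h2
  exact h2.of_inv

theorem inv_next_mem {A : Set E} (h : ∀ c, ∀ e ∈ A, S.next c e ∈ A) (c : VertexColour) {e : E}
    (he : e ∈ A) : (S.next c)⁻¹ e ∈ A := by
  have hpow : ∀ n : ℕ, (S.next c)^[n] e ∈ A := fun n => by
    induction n with
    | zero => exact he
    | succ n ih => rw [Function.iterate_succ_apply']; exact h c _ ih
  obtain ⟨n, hn, hp⟩ := S.periodic c e
  obtain ⟨k, rfl⟩ := Nat.exists_eq_add_of_lt hn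
  rw [zero_add, Function.IsPeriodicPt, Function.IsFixedPt, Function.iterate_succ_apply'] at hp
  rw [Equiv.Perm.inv_eq_iff_eq.2 hp.symm]
  exact hpow k

theorem mem_of_tail_eq (hS : S.IsPolygonal) {A : Set E} (h : ∀ c, ∀ e ∈ A, S.next c e ∈ A)
    {e f : E} (he : e ∈ A) (hf : S.tail e = S.tail f) : f ∈ A := by
  have hpow : ∀ (n : ℕ) (σ : Equiv.Perm E), (∀ e ∈ A, σ e ∈ A) → (σ ^ n) e ∈ A := by
    intro n σ hσ
    induction n with
    | zero => exact he
    | succ n ih => rw [pow_succ', Equiv.Perm.mul_apply]; exact hσ _ ih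
  obtain ⟨z, rfl⟩ := hS e f hf
  obtain ⟨n, rfl | rfl⟩ := z.eq_nat_or_neg
  · rw [zpow_natCast]
    exact hpow n _ fun e he => h _ _ (inv_next_mem h _ he)
  · rw [zpow_neg, zpow_natCast, ← inv_pow, mul_inv_rev, inv_inv]
    exact hpow n _ fun e he => h _ _ (inv_next_mem h _ he)

theorem HasNoFiniteComponent.op (hS : S.HasNoFiniteComponent) : S.op.HasNoFiniteComponent :=
  fun A hA h => hS A hA fun c _ he => inv_next_mem h c he

namespace IsConsistentPlane

/-- Reversal puts the loops at the start of the paths. Centrality moves them back to the end, so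
cancellation and comparison carry over. -/
theorem op (hS : S.IsConsistentPlane) : S.op.IsConsistentPlane where
  isPolygonal := hS.isPolygonal.op
  exists_tail_eq j := by
    obtain ⟨a, ha⟩ := hS.exists_tail_eq j
    exact ⟨(S.next .black)⁻¹ a, by
      rw [← ha, ← perm_apply_inv_apply (S.next .black) a, S.tail_next]
      simp [RotationSystem.op]⟩
  finite_tail_eq j := by
    refine Set.Finite.of_finite_image ((hS.finite_tail_eq j).subset ?_)
      (S.next .black).injective.injOn
    rintro _ ⟨a, ha, rfl⟩
    exact (S.tail_next .black a).trans ha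
  cancel {i j u v ω} hu hv hω h := by
    obtain ⟨ω', hω'⟩ := hS.exists_isLoop i
    have h1 : S.Eqv (ω.reverse ++ u.reverse) (ω.reverse ++ v.reverse) := by
      simpa using h.op
    have h2 := ((IsLoop.op hω).eqv_append_comm hS.isPolygonal hω' hu.op).symm.trans
      (h1.trans ((IsLoop.op hω).eqv_append_comm hS.isPolygonal hω' hv.op))
    simpa using (hS.cancel hu.op hv.op hω' h2).op
  exists_rep {i j u v ω} hu hv hω := by
    obtain ⟨ω', hω'⟩ := hS.exists_isLoop i
    obtain ⟨m, n, h⟩ := hS.exists_rep hu.op hv.op hω'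
    have h1 := (eqv_rep_append_comm hS.isPolygonal (IsLoop.op hω) hω' hu.op m).trans
      (h.trans (eqv_rep_append_comm hS.isPolygonal (IsLoop.op hω) hω' hv.op n).symm)
    refine ⟨m, n, ?_⟩
    simpa [reverse_rep] using h1.op
  exists_isPath i j := by
    obtain ⟨l, hl⟩ := hS.exists_isPath j i
    exact ⟨_, hl.op⟩
  hasNoFiniteComponent := hS.hasNoFiniteComponent.op

theorem exists_isMinimal_cons (hS : S.IsConsistentPlane) (i j : T) :
    ∃ a m, S.head a = j ∧ S.IsPath j m i ∧ S.IsMinimal (a :: m) := by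
  obtain ⟨a, m, ha, hm, hmin⟩ := hS.op.exists_isMinimal_append i j
  exact ⟨a, m.reverse, ha, hm.op, by simpa using hmin.op⟩

end IsConsistentPlane

end RotationSystem

/-! ### F-term equivalence as equivalence under moves. -/

namespace BraneTiling

variable {g : ℕ} {F : BraneTiling.{u} g}

instance finiteEdge : Finite F.Edge := F.finite_edge

variable (F) in
/-- The dual quiver of a tiling as a rotation system. -/
def rotationSystem : RotationSystem F.Edge F.Tile where
  tail := F.tail
  head := F.head
  next := F.next
  tail_next := F.tail_next
  periodic c e := (F.next c).injective.mem_periodicPts e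
  next_ne := F.next_ne

theorem isPolygonal : F.rotationSystem.IsPolygonal := F.sameCycle_of_tail_eq

/-- The list of the arrows of a path. -/
def edges {i : F.Tile} : {j : F.Tile} → Quiver.Path i j → List F.Edge
  | _, .nil => []
  | _, .cons p a => edges p ++ [a.1]

@[simp] theorem edges_nil {i : F.Tile} : edges (Quiver.Path.nil : Quiver.Path i i) = [] := rfl

@[simp] theorem edges_cons {i j k : F.Tile} (p : Quiver.Path i j) (a : j ⟶ k) :
    edges (p.cons a) = edges p ++ [a.1] := rfl

@[simp] theorem edges_toPath {i j : F.Tile} (a : i ⟶ j) : edges a.toPath = [a.1] := rfl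

@[simp] theorem edges_comp {i j k : F.Tile} (p : Quiver.Path i j) (q : Quiver.Path j k) :
    edges (p.comp q) = edges p ++ edges q := by
  induction q with
  | nil => simp
  | cons q a ih => rw [Quiver.Path.comp_cons, edges_cons, ih, edges_cons, List.append_assoc]

theorem isPath_edges {i j : F.Tile} (p : Quiver.Path i j) :
    F.rotationSystem.IsPath i (edges p) j := by
  induction p with
  | nil => rfl
  | cons p a ih => exact ih.append ⟨a.2.1, a.2.2⟩

theorem exists_edges_eq {i j : F.Tile} {l : List F.Edge} (h : F.rotationSystem.IsPath i l j) :
    ∃ p : Quiver.Path i j, edges p = l := by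
  induction l generalizing i with
  | nil =>
    obtain rfl : i = j := h
    exact ⟨.nil, rfl⟩
  | cons e l ih =>
    obtain ⟨p, hp⟩ := ih h.2
    exact ⟨(Quiver.Hom.toPath (⟨e, h.1, rfl⟩ : i ⟶ F.head e)).comp p, by
      rw [edges_comp, hp]; rfl⟩

theorem edges_injective {i j : F.Tile} {p q : Quiver.Path i j} (h : edges p = edges q) :
    p = q := by
  induction p with
  | nil =>
    cases q with
    | nil => rfl
    | cons q b => simp at h
  | @cons j k p a ih =>
    cases q with
    | nil => simp at h
    | @cons j' _ q b =>
      obtain ⟨h1, h2⟩ := List.append_inj' h rfl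
      obtain ⟨a, ha, ha'⟩ := a
      obtain ⟨b, hb, hb'⟩ := b
      obtain rfl : a = b := by simpa using h2
      subst ha
      subst hb
      rw [ih h1]

theorem edges_cast {i j i' j' : F.Tile} (hi : i = i') (hj : j = j') (p : Quiver.Path i j) :
    edges (p.cast hi hj) = edges p := by
  subst hi hj
  rfl

theorem edges_follow (c : VertexColour) (e : F.Edge) (k : ℕ) :
    edges (F.follow c e k) = (List.range k).map fun n => (F.next c)^[n + 1] e := by
  induction k with
  | zero => rfl
  | succ k ih => rw [follow, edges_cons, ih, List.range_succ, List.map_append]; rfl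

theorem edges_brokenLoop (c : VertexColour) (e : F.Edge) :
    edges (F.brokenLoop c e) = around (F.next c) e := by
  rw [brokenLoop, edges_cast, edges_follow, around]

theorem edges_arrow_comp_brokenLoop (c : VertexColour) (e : F.Edge) :
    edges ((F.arrow e).toPath.comp (F.brokenLoop c e)) = e :: around (F.next c) e := by
  rw [edges_comp, edges_brokenLoop]
  rfl

theorem isLoop_edges {i : F.Tile} {ω : Quiver.Path i i} (h : IsSimpleLoop ω) :
    F.rotationSystem.IsLoop i (edges ω) := by
  obtain ⟨c, e⟩ := h
  exact ⟨c, e, rfl, edges_arrow_comp_brokenLoop c e⟩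

theorem isSimpleLoop_of_edges_eq {i : F.Tile} {ω : Quiver.Path i i}
    (h : F.rotationSystem.IsLoop i (edges ω)) : IsSimpleLoop ω := by
  obtain ⟨c, e, rfl, h⟩ := h
  have : ω = (F.arrow e).toPath.comp (F.brokenLoop c e) :=
    edges_injective (h.trans (edges_arrow_comp_brokenLoop c e).symm)
  rw [this]
  exact .mk c e

/-- The linear map to the free vector space on move classes kills the F-term ideal, while distinct
classes remain distinct basis vectors. Equality in `A_F` therefore involves no more than a chain of
moves. -/
theorem eqv_edges {i j : F.Tile} {p q : Quiver.Path i j} (h : FTermEquiv p q) :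
    F.rotationSystem.Eqv (edges p) (edges q) := by
  let cl : Quiver.Path i j → Quot F.rotationSystem.Move := fun p => Quot.mk _ (edges p)
  have hker : fTermIdeal i j ≤ LinearMap.ker (Finsupp.lmapDomain ℂ ℂ cl) := by
    refine Submodule.span_le.2 ?_
    rintro _ ⟨e, u, v, rfl⟩
    rw [SetLike.mem_coe, LinearMap.mem_ker, Finsupp.lmapDomain_apply, fTerm,
      Finsupp.mapDomain_sub, Finsupp.mapDomain_single, Finsupp.mapDomain_single,
      Finsupp.mapDomain_sub, Finsupp.mapDomain_single, Finsupp.mapDomain_single, sub_eq_zero]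
    congr 1
    refine Quot.sound ⟨edges u, e, edges v, ?_, ?_⟩
    · rw [edges_comp, edges_comp, edges_brokenLoop]
      rfl
    · rw [edges_comp, edges_comp, edges_brokenLoop]
      rfl
  have h1 := hker h
  rw [LinearMap.mem_ker, map_sub, sub_eq_zero, Finsupp.lmapDomain_apply, Finsupp.lmapDomain_apply,
    Finsupp.mapDomain_single, Finsupp.mapDomain_single] at h1
  exact Quot.eqvGen_exact (Finsupp.single_left_injective one_ne_zero h1)

theorem fTermEquiv_of_eqv {l l' : List F.Edge} (h : F.rotationSystem.Eqv l l') {i j : F.Tile}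
    {p q : Quiver.Path i j} (hp : edges p = l) (hq : edges q = l') : FTermEquiv p q := by
  unfold FTermEquiv
  induction h generalizing p q with
  | rel l l' h =>
    obtain ⟨u, a, v, rfl, rfl⟩ := h
    obtain ⟨k, hk, hv⟩ := RotationSystem.isPath_append.1 (hp ▸ isPath_edges p)
    obtain ⟨k', hu, hk⟩ := RotationSystem.isPath_append.1 hk
    have h1 : F.rotationSystem.IsPath _ _ _ :=
      RotationSystem.isPath_around (S := F.rotationSystem) .black a
    have hk' : k' = F.head a := by
      obtain ⟨e, l, hl⟩ := List.exists_cons_of_ne_nil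
        (RotationSystem.around_next_ne_nil (S := F.rotationSystem) .black a)
      rw [hl] at hk h1
      exact hk.1.symm.trans h1.1
    subst hk'
    obtain rfl : F.tail a = k := h1.end_unique hk
    obtain ⟨u, rfl⟩ := exists_edges_eq hu
    obtain ⟨v, rfl⟩ := exists_edges_eq hv
    have hp' : p = (u.comp (F.brokenLoop .black a)).comp v := by
      apply edges_injective
      rw [hp, edges_comp, edges_comp, edges_brokenLoop]
      rfl
    have hq' : q = (u.comp (F.brokenLoop .white a)).comp v := by
      apply edges_injective
      rw [hq, edges_comp, edges_comp, edges_brokenLoop]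
      rfl
    refine Submodule.subset_span ⟨a, u, v, ?_⟩
    rw [fTerm, Finsupp.mapDomain_sub, Finsupp.mapDomain_single, Finsupp.mapDomain_single, hp', hq']
  | refl l =>
    rw [edges_injective (hp.trans hq.symm), sub_self]
    exact Submodule.zero_mem _
  | symm l l' h ih =>
    rw [← neg_sub]
    exact Submodule.neg_mem _ (ih hq hp)
  | trans l l' l'' h h' ih ih' =>
    obtain ⟨r, hr⟩ := exists_edges_eq ((hp ▸ isPath_edges p).of_eqv h)
    rw [← sub_add_sub_cancel _ (Finsupp.single r 1)]
    exact Submodule.add_mem _ (ih hp hr) (ih' hr hq)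

/-- Cancellation of loops in a consistent tiling. -/
theorem Consistent.cancel (hF : F.Consistent) {i j : F.Tile} {u v ω : List F.Edge}
    (hu : F.rotationSystem.IsPath i u j) (hv : F.rotationSystem.IsPath i v j)
    (hω : F.rotationSystem.IsLoop j ω) (h : F.rotationSystem.Eqv (u ++ ω) (v ++ ω)) :
    F.rotationSystem.Eqv u v := by
  obtain ⟨u, rfl⟩ := exists_edges_eq hu
  obtain ⟨v, rfl⟩ := exists_edges_eq hv
  obtain ⟨ω, rfl⟩ := exists_edges_eq hω.isPath
  refine eqv_edges (hF i j u v ⟨ω, 1, isSimpleLoop_of_edges_eq hω, ?_⟩)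
  refine fTermEquiv_of_eqv h ?_ ?_ <;> simp [loopPow]

end BraneTiling

/-! ### Coverings of rotation systems. -/

namespace RotationSystem

variable {E T E' T' : Type*}

theorem map_rep (p : E' → E) (ω : List E') (n : ℕ) : (rep ω n).map p = rep (ω.map p) n := by
  induction n with
  | zero => rfl
  | succ n ih => rw [rep_succ, rep_succ, List.map_append, ih]

/-- A covering map of rotation systems, given by its effect on arrows and on tiles. -/
structure IsCovering (S' : RotationSystem E' T') (S : RotationSystem E T) (p : E' → E)
    (π : T' → T) : Prop where
  tail_map : ∀ a, S.tail (p a) = π (S'.tail a)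
  head_map : ∀ a, S.head (p a) = π (S'.head a)
  next_map : ∀ c a, p (S'.next c a) = S.next c (p a)
  minimalPeriod_map : ∀ c a,
    Function.minimalPeriod (S'.next c) a = Function.minimalPeriod (S.next c) (p a)
  exists_lift : ∀ x e, S.tail e = π x → ∃ a, S'.tail a = x ∧ p a = e
  lift_unique : ∀ a a', S'.tail a = S'.tail a' → p a = p a' → a = a'

namespace IsCovering

variable {S' : RotationSystem E' T'} {S : RotationSystem E T} {p : E' → E} {π : T' → T}
  (h : S'.IsCovering S p π)
include h

theorem map_around (c : VertexColour) (a : E') :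
    (around (S'.next c) a).map p = around (S.next c) (p a) :=
  _root_.map_around (h.next_map c) (h.minimalPeriod_map c a)

theorem isPath_map {x y : T'} {l : List E'} (hl : S'.IsPath x l y) :
    S.IsPath (π x) (l.map p) (π y) := by
  induction l generalizing x with
  | nil => exact congrArg π hl
  | cons a l ih => exact ⟨(h.tail_map a).trans (congrArg π hl.1), h.head_map a ▸ ih hl.2⟩

theorem list_lift_unique {x y y' : T'} {l l' : List E'} (hl : S'.IsPath x l y)
    (hl' : S'.IsPath x l' y') (hp : l.map p = l'.map p) : l = l' := by
  induction l generalizing x l' with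
  | nil => exact (List.map_eq_nil_iff.1 hp.symm).symm
  | cons a l ih =>
    cases l' with
    | nil => simp at hp
    | cons a' l' =>
      rw [List.map_cons, List.map_cons, List.cons.injEq] at hp
      obtain rfl := h.lift_unique a a' (hl.1.trans hl'.1.symm) hp.1
      rw [ih hl.2 hl'.2 hp.2]

theorem isLoop_map {x : T'} {ω : List E'} (hω : S'.IsLoop x ω) : S.IsLoop (π x) (ω.map p) := by
  obtain ⟨c, a, rfl, rfl⟩ := hω
  exact ⟨c, p a, h.tail_map a, by rw [List.map_cons, h.map_around]⟩

theorem isLoop_of_map {x y : T'} {j : T} {ω : List E'} (hx : S'.IsPath x ω y)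
    (hω : S.IsLoop j (ω.map p)) : S'.IsLoop x ω := by
  obtain ⟨c, e, -, hω⟩ := hω
  cases ω with
  | nil => simp at hω
  | cons a ω =>
    rw [List.map_cons, List.cons.injEq] at hω
    obtain ⟨rfl, hω⟩ := hω
    refine ⟨c, a, hx.1, ?_⟩
    rw [← h.map_around] at hω
    rw [h.list_lift_unique hx.2 (isPath_around c a) hω]

theorem eqv_map {l l' : List E'} (hl : S'.Eqv l l') : S.Eqv (l.map p) (l'.map p) := by
  induction hl with
  | rel l l' hl =>
    obtain ⟨u, a, v, rfl, rfl⟩ := hl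
    exact Relation.EqvGen.rel _ _ ⟨u.map p, p a, v.map p, by simp [h.map_around],
      by simp [h.map_around]⟩
  | refl l => exact Eqv.refl _
  | symm _ _ _ ih => exact ih.symm
  | trans _ _ _ _ _ ih ih' => exact ih.trans ih'

theorem exists_append_around {x y : T'} {l : List E'} (hl : S'.IsPath x l y) {c : VertexColour}
    {u v : List E} {a : E} (hm : l.map p = u ++ around (S.next c) a ++ v) :
    ∃ u' a' v', l = u' ++ around (S'.next c) a' ++ v' ∧ u'.map p = u ∧ p a' = a ∧
      v'.map p = v := by
  obtain ⟨w, v', rfl, hw, rfl⟩ := List.map_eq_append_iff.1 hm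
  obtain ⟨u', o, rfl, rfl, ho⟩ := List.map_eq_append_iff.1 hw
  obtain ⟨k, hk, -⟩ := isPath_append.1 hl
  obtain ⟨k', -, hk⟩ := isPath_append.1 hk
  cases o with
  | nil => exact absurd ho.symm (around_next_ne_nil c a)
  | cons f o =>
    have hfa : p f = S.next c a := by
      have := around_append_singleton (S.periodic c a)
      rw [← ho] at this
      exact (List.cons.inj this).1
    have hpa : p ((S'.next c)⁻¹ f) = a := by
      apply (S.next c).injective
      rw [← h.next_map, perm_apply_inv_apply, hfa]
    refine ⟨u', (S'.next c)⁻¹ f, v', ?_, rfl, hpa, rfl⟩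
    have hst : S'.head ((S'.next c)⁻¹ f) = k' := by
      rw [← S'.tail_next c, perm_apply_inv_apply, hk.1]
    rw [h.list_lift_unique hk (hst ▸ isPath_around c _) (by rw [ho, h.map_around, hpa])]

/-- Vertices lift with the same valency, so each move downstairs lifts. Both directions are carried
along so that the induction passes through symmetry. -/
theorem exists_eqv_lift {l l' : List E} (hl : S.Eqv l l') :
    (∀ x y m, S'.IsPath x m y → m.map p = l → ∃ m', m'.map p = l' ∧ S'.Eqv m m') ∧
    (∀ x y m, S'.IsPath x m y → m.map p = l' → ∃ m', m'.map p = l ∧ S'.Eqv m m') := by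
  induction hl with
  | rel l l' hl =>
    obtain ⟨u, a, v, rfl, rfl⟩ := hl
    have key : ∀ c c' x y m, S'.IsPath x m y → m.map p = u ++ around (S.next c) a ++ v →
        ∃ m', m'.map p = u ++ around (S.next c') a ++ v ∧ S'.Eqv m m' := by
      intro c c' x y m hm hml
      obtain ⟨u', a', v', rfl, rfl, rfl, rfl⟩ := h.exists_append_around hm hml
      exact ⟨u' ++ around (S'.next c') a' ++ v', by simp [h.map_around],
        (eqv_around c c' a').append_both u' v'⟩
    exact ⟨key _ _, key _ _⟩
  | refl l =>
    exact ⟨fun x y m _ hm => ⟨m, hm, Eqv.refl _⟩, fun x y m _ hm => ⟨m, hm, Eqv.refl _⟩⟩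
  | symm _ _ _ ih => exact ⟨ih.2, ih.1⟩
  | trans _ _ _ _ _ ih ih' =>
    constructor
    · intro x y m hm hml
      obtain ⟨m', hm', he⟩ := ih.1 x y m hm hml
      obtain ⟨m'', hm'', he'⟩ := ih'.1 x y m' (hm.of_eqv he) hm'
      exact ⟨m'', hm'', he.trans he'⟩
    · intro x y m hm hml
      obtain ⟨m', hm', he⟩ := ih'.2 x y m hm hml
      obtain ⟨m'', hm'', he'⟩ := ih.2 x y m' (hm.of_eqv he) hm'
      exact ⟨m'', hm'', he.trans he'⟩

theorem eqv_of_map {x y y' : T'} {l l' : List E'} (hl : S'.IsPath x l y)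
    (hl' : S'.IsPath x l' y') (he : S.Eqv (l.map p) (l'.map p)) : S'.Eqv l l' := by
  obtain ⟨m, hm, hlm⟩ := (h.exists_eqv_lift he).1 x y l hl rfl
  rwa [h.list_lift_unique (hl.of_eqv hlm) hl' hm] at hlm

theorem isPolygonal (hS : S.IsPolygonal) : S'.IsPolygonal := by
  intro a a' ha
  have hmap : ∀ a, p ((S'.next .black * (S'.next .white)⁻¹) a)
      = (S.next .black * (S.next .white)⁻¹) (p a) := by
    intro a
    rw [Equiv.Perm.mul_apply, Equiv.Perm.mul_apply, h.next_map]
    congr 1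
    apply (S.next .white).injective
    rw [← h.next_map, perm_apply_inv_apply, perm_apply_inv_apply]
  have hpow : ∀ (n : ℕ) a, p (((S'.next .black * (S'.next .white)⁻¹) ^ n) a)
      = ((S.next .black * (S.next .white)⁻¹) ^ n) (p a) ∧
      S'.tail (((S'.next .black * (S'.next .white)⁻¹) ^ n) a) = S'.tail a := by
    intro n a
    induction n with
    | zero => exact ⟨rfl, rfl⟩
    | succ n ih =>
      rw [pow_succ', pow_succ']
      exact ⟨(hmap _).trans (congrArg _ ih.1), (tail_sigma _).trans ih.2⟩
  obtain ⟨z, hz⟩ := hS (p a) (p a') (by rw [h.tail_map, h.tail_map, ha])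
  obtain ⟨n, rfl | rfl⟩ := z.eq_nat_or_neg
  · rw [zpow_natCast] at hz
    refine ⟨n, ?_⟩
    rw [zpow_natCast]
    exact h.lift_unique _ _ ((hpow n a).2.trans ha) ((hpow n a).1.trans hz)
  · rw [zpow_neg, zpow_natCast, Equiv.Perm.inv_eq_iff_eq] at hz
    refine ⟨-n, ?_⟩
    rw [zpow_neg, zpow_natCast, Equiv.Perm.inv_eq_iff_eq]
    exact h.lift_unique _ _ (ha.trans (hpow n a').2.symm) (hz.trans (hpow n a').1.symm)

end IsCovering

end RotationSystem

/-! ### Agreement up to loops, and homotopy. -/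

namespace RotationSystem

variable {E T : Type*} {S : RotationSystem E T}

variable (S) in
/-- Two paths to `j` agree up to revolutions around vertices. -/
def Weak (j : T) (u v : List E) : Prop :=
  ∃ ω m n, S.IsLoop j ω ∧ S.Eqv (u ++ rep ω m) (v ++ rep ω n)

theorem Weak.symm {j : T} {u v : List E} (h : S.Weak j u v) : S.Weak j v u := by
  obtain ⟨ω, m, n, hω, h⟩ := h
  exact ⟨ω, n, m, hω, h.symm⟩

theorem Weak.exists_rep (hS : S.IsPolygonal) {j : T} {u v ω : List E} (h : S.Weak j u v)
    (hω : S.IsLoop j ω) : ∃ m n, S.Eqv (u ++ rep ω m) (v ++ rep ω n) := by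
  obtain ⟨ω', m, n, hω', h⟩ := h
  exact ⟨m, n, (((eqv_rep hS hω hω' m).append_left u).trans h).trans
    ((eqv_rep hS hω' hω n).append_left v)⟩

theorem Weak.trans (hS : S.IsPolygonal) {j : T} {u v w : List E} (h : S.Weak j u v)
    (h' : S.Weak j v w) : S.Weak j u w := by
  obtain ⟨ω, m, n, hω, h⟩ := h
  obtain ⟨m', n', h'⟩ := h'.exists_rep hS hω
  refine ⟨ω, m + m', n' + n, hω, ?_⟩
  rw [rep_add, rep_add, ← List.append_assoc, ← List.append_assoc]
  refine (h.append_right _).trans (Eqv.trans ?_ (h'.append_right _))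
  rw [List.append_assoc, List.append_assoc, ← rep_add, ← rep_add, Nat.add_comm]
  exact Eqv.refl _

theorem Weak.append (hS : S.IsPolygonal) {j k : T} {u v w ω : List E} (h : S.Weak j u v)
    (hw : S.IsPath j w k) (hω : S.IsLoop k ω) : S.Weak k (u ++ w) (v ++ w) := by
  obtain ⟨ω', m, n, hω', h⟩ := h
  refine ⟨ω, m, n, hω, ?_⟩
  rw [List.append_assoc, List.append_assoc]
  refine ((eqv_rep_append_comm hS hω' hω hw m).symm.append_left u).trans (Eqv.trans ?_
    ((eqv_rep_append_comm hS hω' hω hw n).append_left v))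
  simpa using h.append_right w

theorem Weak.append_loop {j : T} {u ω : List E} (hω : S.IsLoop j ω) : S.Weak j (u ++ ω) u :=
  ⟨ω, 0, 1, hω, by simpa [rep] using Eqv.refl (u ++ ω)⟩

end RotationSystem

/-- Types and bijections, as a groupoid. -/
structure BijectionGroupoid : Type (u + 1) where
  carrier : Type u

instance : Groupoid BijectionGroupoid.{u} where
  Hom A B := A.carrier ≃ B.carrier
  id A := Equiv.refl _
  comp f g := f.trans g
  inv f := f.symm
  inv_comp f := f.symm_trans_self
  comp_inv f := f.self_trans_symm

/-- A morphism of `BijectionGroupoid` as a bijection. -/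
def BijectionGroupoid.Hom.toEquiv {A B : BijectionGroupoid.{u}} (f : A ⟶ B) :
    A.carrier ≃ B.carrier := f

namespace BraneTiling

variable {g : ℕ} {F : BraneTiling.{u} g}

theorem exists_isLoop (j : F.Tile) : ∃ ω, F.rotationSystem.IsLoop j ω := by
  obtain ⟨e, he⟩ := F.tail_surjective j
  exact ⟨_, .black, e, he, rfl⟩

/-- The homotopy class of a path. -/
def pathClass {i j : F.Tile} (p : Quiver.Path i j) : F.fundObj i ⟶ F.fundObj j :=
  (CategoryTheory.Quotient.functor F.SimpleLoopRel).map (F.freeClass p)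

theorem pathClass_nil (i : F.Tile) : pathClass (Quiver.Path.nil : Quiver.Path i i) = 𝟙 _ :=
  (CategoryTheory.Quotient.functor F.SimpleLoopRel).map_id _

theorem pathClass_cons {i j k : F.Tile} (p : Quiver.Path i j) (a : j ⟶ k) :
    pathClass (p.cons a) = pathClass p ≫ fundClass a :=
  (CategoryTheory.Quotient.functor F.SimpleLoopRel).map_comp _ _

theorem pathClass_comp {i j k : F.Tile} (p : Quiver.Path i j) (q : Quiver.Path j k) :
    pathClass (p.comp q) = pathClass p ≫ pathClass q := by
  induction q with
  | nil => rw [Quiver.Path.comp_nil, pathClass_nil, Category.comp_id]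
  | cons q a ih => rw [Quiver.Path.comp_cons, pathClass_cons, ih, pathClass_cons, Category.assoc]

theorem pathClass_toPath {i j : F.Tile} (a : i ⟶ j) : pathClass a.toPath = fundClass a := by
  rw [Quiver.Hom.toPath, pathClass_cons, pathClass_nil, Category.id_comp]

theorem pathClass_of_isSimpleLoop {i : F.Tile} {ω : Quiver.Path i i} (h : IsSimpleLoop ω) :
    pathClass ω = 𝟙 _ :=
  (CategoryTheory.Quotient.sound _ (SimpleLoopRel.mk ω h)).trans
    ((CategoryTheory.Quotient.functor F.SimpleLoopRel).map_id _)

theorem exists_comp_fundClass_eq_id {i j : F.Tile} (a : i ⟶ j) :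
    ∃ p : Quiver.Path j i, fundClass a ≫ pathClass p = 𝟙 _ := by
  obtain ⟨e, rfl, rfl⟩ := a
  refine ⟨F.brokenLoop .black e, ?_⟩
  have h := pathClass_of_isSimpleLoop (IsSimpleLoop.mk VertexColour.black e)
  rwa [pathClass_comp, pathClass_toPath] at h

/-- The broken loop of an arrow represents its inverse, so every backward step of a walk can be
replaced by a forward path. -/
theorem exists_pathClass_eq {i j : F.Tile} (γ : F.fundObj i ⟶ F.fundObj j) :
    ∃ p : Quiver.Path i j, pathClass p = γ := by
  obtain ⟨γ, rfl⟩ := (CategoryTheory.Quotient.functor F.SimpleLoopRel).map_surjective γ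
  obtain ⟨γ⟩ := γ
  have key : ∀ {k : Quiver.Symmetrify F.Tile} (q : Quiver.Path (V := Quiver.Symmetrify F.Tile) i k),
      ∃ p : Quiver.Path (V := F.Tile) i k, pathClass p =
        (CategoryTheory.Quotient.functor F.SimpleLoopRel).map
          ((CategoryTheory.Quotient.functor Quiver.FreeGroupoid.redStep).map q) := by
    intro k q
    induction q with
    | nil => exact ⟨.nil, rfl⟩
    | @cons k l q a ih =>
      obtain ⟨p, hp⟩ := ih
      rcases a with a | a
      · exact ⟨p.cons a, (pathClass_cons p a).trans (congrArg (· ≫ fundClass a) hp)⟩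
      · obtain ⟨r, hr⟩ := exists_comp_fundClass_eq_id a
        refine ⟨p.comp r, (pathClass_comp p r).trans ?_⟩
        have hinv : pathClass r = Groupoid.inv (fundClass a) := by
          rw [← Category.id_comp (pathClass r), ← Groupoid.inv_comp (fundClass a), Category.assoc, hr,
            Category.comp_id]
        rw [hinv]
        exact congrArg (· ≫ Groupoid.inv (fundClass a)) hp
  exact key γ

section Lift

variable {G : Type*} [Groupoid G] (φ : F.Tile ⥤q G)
  (hφ : ∀ {i : F.Tile} (ω : Quiver.Path i i), IsSimpleLoop ω → composePath (φ.mapPath ω) = 𝟙 _)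

theorem lift_map_freeClass {i j : F.Tile} (p : Quiver.Path i j) :
    (Quiver.FreeGroupoid.lift φ).map (F.freeClass p) = composePath (φ.mapPath p) := by
  induction p with
  | nil => exact (Quiver.FreeGroupoid.lift φ).map_id _
  | cons p a ih =>
    refine ((Quiver.FreeGroupoid.lift φ).map_comp _ _).trans ?_
    exact congrArg₂ (· ≫ ·) ih (Category.id_comp (φ.map a))

/-- The functor on the fundamental groupoid given by the images of the arrows. -/
def fundLift : F.FundGroupoid ⥤ G :=
  CategoryTheory.Quotient.lift _ (Quiver.FreeGroupoid.lift φ) (by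
    rintro _ _ _ _ ⟨ω, hω⟩
    rw [lift_map_freeClass, hφ ω hω]
    exact ((Quiver.FreeGroupoid.lift φ).map_id _).symm)

theorem fundLift_map_pathClass {i j : F.Tile} (p : Quiver.Path i j) :
    (fundLift φ hφ).map (pathClass p) = composePath (φ.mapPath p) :=
  lift_map_freeClass φ p

end Lift

/-- Agreement up to revolutions around vertices, on the paths from `i` to `j`. -/
def weakSetoid (i j : F.Tile) : Setoid {l // F.rotationSystem.IsPath i l j} where
  r u v := F.rotationSystem.Weak j u.1 v.1
  iseqv := by
    refine ⟨fun u => ?_, fun h => h.symm, fun h h' => h.trans isPolygonal h'⟩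
    obtain ⟨ω, hω⟩ := exists_isLoop j
    exact ⟨ω, 0, 0, hω, .refl _⟩

/-- The paths from `i` to `j` up to revolutions around vertices. -/
abbrev WeakFibre (i j : F.Tile) : Type u := _root_.Quotient (weakSetoid i j)

/-- Appending a fixed path. -/
def weakAppend (i : F.Tile) {j k : F.Tile} (w : List F.Edge) (hw : F.rotationSystem.IsPath j w k) :
    WeakFibre i j → WeakFibre i k :=
  Quotient.map' (fun u => ⟨u.1 ++ w, u.2.append hw⟩) fun _ _ h =>
    (exists_isLoop k).elim fun _ hω => RotationSystem.Weak.append isPolygonal h hw hω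

theorem weakAppend_weakAppend {i j k : F.Tile} {w w' : List F.Edge}
    (hw : F.rotationSystem.IsPath j w k) (hw' : F.rotationSystem.IsPath k w' j)
    (h : F.rotationSystem.IsLoop j (w ++ w')) (x : WeakFibre i j) :
    weakAppend i w' hw' (weakAppend i w hw x) = x := by
  induction x using Quotient.inductionOn' with
  | h u =>
    refine Quotient.sound' ?_
    change F.rotationSystem.Weak j ((u.1 ++ w) ++ w') u.1
    rw [List.append_assoc]
    exact RotationSystem.Weak.append_loop h

theorem isPath_around_arrow {j k : F.Tile} (a : j ⟶ k) :
    F.rotationSystem.IsPath k (around (F.next .black) a.1) j := by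
  obtain ⟨e, rfl, rfl⟩ := a
  exact RotationSystem.isPath_around (S := F.rotationSystem) .black e

theorem isLoop_around_append_arrow {j k : F.Tile} (a : j ⟶ k) :
    F.rotationSystem.IsLoop k (around (F.next .black) a.1 ++ [a.1]) := by
  obtain ⟨e, rfl, rfl⟩ := a
  exact RotationSystem.isLoop_around_append (S := F.rotationSystem) .black e

/-- Appending an arrow is invertible up to revolutions around vertices. -/
noncomputable def weakEquiv (i : F.Tile) {j k : F.Tile} (a : j ⟶ k) :
    WeakFibre i j ≃ WeakFibre i k where
  toFun := weakAppend i [a.1] ⟨a.2.1, a.2.2⟩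
  invFun := weakAppend i (around (F.next .black) a.1) (isPath_around_arrow a)
  left_inv := weakAppend_weakAppend _ _ ⟨.black, a.1, a.2.1, rfl⟩
  right_inv := weakAppend_weakAppend _ _ (isLoop_around_append_arrow a)

/-- The action of arrows on the paths from `i` up to revolutions around vertices. -/
noncomputable def weakPrefunctor (i : F.Tile) : F.Tile ⥤q BijectionGroupoid.{u} where
  obj j := ⟨WeakFibre i j⟩
  map a := weakEquiv i a

theorem weakPrefunctor_mapPath (i : F.Tile) {j k : F.Tile} (p : Quiver.Path j k)
    (x : WeakFibre i j) :
    BijectionGroupoid.Hom.toEquiv (composePath ((weakPrefunctor i).mapPath p)) x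
      = weakAppend i (edges p) (isPath_edges p) x := by
  induction x using Quotient.inductionOn' with
  | h u =>
    induction p with
    | nil =>
      refine congrArg (Quotient.mk'' (s₁ := weakSetoid i j)) (Subtype.ext ?_)
      exact (List.append_nil _).symm
    | cons p a ih =>
      refine (congrArg (weakEquiv i a) ih).trans ?_
      refine congrArg (Quotient.mk'' (s₁ := weakSetoid i _)) (Subtype.ext ?_)
      exact List.append_assoc _ _ _

/-- Appending arrows acts by bijections on paths from `i` modulo loops, and loops act trivially, so
the action factors through the fundamental groupoid. Applied to the class of the empty path, it
recovers the class of each path. -/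
theorem weak_of_pathClass_eq {i j : F.Tile} {p q : Quiver.Path i j}
    (h : pathClass p = pathClass q) : F.rotationSystem.Weak j (edges p) (edges q) := by
  have hφ : ∀ {j : F.Tile} (ω : Quiver.Path j j), IsSimpleLoop ω →
      composePath ((weakPrefunctor i).mapPath ω) = 𝟙 _ := by
    intro j ω hω
    refine Equiv.ext fun (x : WeakFibre i j) => ?_
    refine (weakPrefunctor_mapPath i ω x).trans ?_
    induction x using Quotient.inductionOn' with
    | h u => exact Quotient.sound' (RotationSystem.Weak.append_loop (isLoop_edges hω))
  have h1 := congrArg (fundLift (weakPrefunctor i) hφ).map h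
  rw [fundLift_map_pathClass, fundLift_map_pathClass] at h1
  let o : WeakFibre i i := Quotient.mk'' ⟨[], rfl⟩
  have h2 := (weakPrefunctor_mapPath i p o).symm.trans
    ((congrArg (fun f => BijectionGroupoid.Hom.toEquiv f o) h1).trans
      (weakPrefunctor_mapPath i q o))
  exact Quotient.exact' (s₁ := weakSetoid i j) h2

end BraneTiling

/-! ### The universal cover as a rotation system. -/

namespace BraneTiling

variable {g : ℕ} {F : BraneTiling.{u} g} {b : F.Tile}

variable (F b) in
/-- The edges of the lifted tiling: an edge of the tiling together with a lift of the tile in which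
the arrow crossing it starts. -/
def CoverEdge : Type u := {p : F.CoverTile b × F.Edge // F.tail p.2 = p.1.1}

namespace CoverEdge

/-- The tile in which an arrow of the lifted quiver starts. -/
def tail (a : F.CoverEdge b) : F.CoverTile b := a.1.1

/-- The underlying edge. -/
def edge (a : F.CoverEdge b) : F.Edge := a.1.2

theorem tail_edge (a : F.CoverEdge b) : F.tail a.edge = a.tail.1 := a.2

/-- The tile in which an arrow of the lifted quiver ends. -/
def head (a : F.CoverEdge b) : F.CoverTile b :=
  ⟨F.head a.edge, a.tail.2 ≫ fundClass ⟨a.edge, a.tail_edge, rfl⟩⟩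

theorem ext {a a' : F.CoverEdge b} (h : a.tail = a'.tail) (h' : a.edge = a'.edge) : a = a' :=
  Subtype.ext (Prod.ext h h')

/-- The successor of an arrow around its end of colour `c`. -/
def nextFun (c : VertexColour) (a : F.CoverEdge b) : F.CoverEdge b :=
  -- Writing the tile as a tail makes the incidence condition hold by `rfl`; it equals the head of
  -- `a` only propositionally.
  ⟨(⟨F.tail (F.next c a.edge), a.tail.2 ≫ fundClass ⟨a.edge, a.tail_edge, (F.tail_next c _).symm⟩⟩,
    F.next c a.edge), rfl⟩

/-- The path with arrows `l` lifts to a path from `x` to `y`. -/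
def Lifts (x : F.CoverTile b) (l : List F.Edge) (y : F.CoverTile b) : Prop :=
  ∃ p : Quiver.Path x.1 y.1, edges p = l ∧ x.2 ≫ pathClass p = y.2

/-- This gives equalities of cover tiles whose underlying tiles agree only propositionally, without
transporting homotopy classes. -/
theorem Lifts.end_unique {x y y' : F.CoverTile b} {l : List F.Edge} (h : Lifts x l y)
    (h' : Lifts x l y') : y = y' := by
  obtain ⟨p, rfl, hp⟩ := h
  obtain ⟨q, hq, hq'⟩ := h'
  obtain ⟨j, γ⟩ := y
  obtain ⟨j', γ'⟩ := y'
  obtain rfl : j = j' := (isPath_edges p).end_unique (hq ▸ isPath_edges q)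
  obtain rfl := edges_injective hq
  exact congrArg (Sigma.mk j) (hp.symm.trans hq')

theorem Lifts.append {x y z : F.CoverTile b} {l l' : List F.Edge} (h : Lifts x l y)
    (h' : Lifts y l' z) : Lifts x (l ++ l') z := by
  obtain ⟨p, rfl, hp⟩ := h
  obtain ⟨q, rfl, hq⟩ := h'
  exact ⟨p.comp q, edges_comp p q, by rw [pathClass_comp, ← Category.assoc, hp, hq]⟩

theorem Lifts.nil (x : F.CoverTile b) : Lifts x [] x :=
  ⟨.nil, rfl, by rw [pathClass_nil, Category.comp_id]⟩

theorem lifts_head (a : F.CoverEdge b) : Lifts a.tail [a.edge] a.head :=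
  ⟨Quiver.Hom.toPath ⟨a.edge, a.tail_edge, rfl⟩, rfl, by rw [pathClass_toPath]; rfl⟩

theorem lifts_tail_nextFun (c : VertexColour) (a : F.CoverEdge b) :
    Lifts a.tail [a.edge] (nextFun c a).tail :=
  ⟨Quiver.Hom.toPath ⟨a.edge, a.tail_edge, (F.tail_next c _).symm⟩, rfl, by
    rw [pathClass_toPath]; rfl⟩

theorem tail_nextFun (c : VertexColour) (a : F.CoverEdge b) : (nextFun c a).tail = a.head :=
  (lifts_tail_nextFun c a).end_unique (lifts_head a)

theorem lifts_of_isSimpleLoop {x : F.CoverTile b} {ω : Quiver.Path x.1 x.1}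
    (h : IsSimpleLoop ω) : Lifts x (edges ω) x :=
  ⟨ω, rfl, by rw [pathClass_of_isSimpleLoop h, Category.comp_id]⟩

theorem edge_iterate_nextFun (c : VertexColour) (a : F.CoverEdge b) (n : ℕ) :
    ((nextFun c)^[n] a).edge = (F.next c)^[n] a.edge :=
  (show Function.Semiconj edge (nextFun c) (F.next c) from fun _ => rfl).iterate_right n a

theorem lifts_iterate_nextFun (c : VertexColour) (a : F.CoverEdge b) (n : ℕ) :
    Lifts a.tail ((List.range n).map fun k => (F.next c)^[k] a.edge) ((nextFun c)^[n] a).tail := by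
  induction n with
  | zero => exact Lifts.nil _
  | succ n ih =>
    rw [List.range_succ, List.map_append, Function.iterate_succ_apply', List.map_singleton,
      ← edge_iterate_nextFun]
    exact ih.append (lifts_tail_nextFun c _)

/-- A revolution around a vertex is null-homotopic, so its lift closes up after one turn. -/
theorem iterate_nextFun_minimalPeriod (c : VertexColour) (a : F.CoverEdge b) :
    (nextFun c)^[Function.minimalPeriod (F.next c) a.edge] a = a := by
  refine ext ((lifts_iterate_nextFun c a _).end_unique ?_) ?_
  · have hc : a.edge :: around (F.next c) a.edge = _ :=
      cons_around (F.rotationSystem.periodic c a.edge)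
    rw [← hc]
    obtain ⟨ω, hω⟩ : ∃ ω : Quiver.Path a.tail.1 a.tail.1, edges ω = a.edge ::
        around (F.next c) a.edge :=
      exists_edges_eq (RotationSystem.IsLoop.isPath ⟨c, a.edge, a.tail_edge, rfl⟩)
    rw [← hω]
    refine lifts_of_isSimpleLoop (isSimpleLoop_of_edges_eq ?_)
    rw [hω]
    exact ⟨c, a.edge, a.tail_edge, rfl⟩
  · rw [edge_iterate_nextFun, Function.iterate_minimalPeriod]

theorem mem_periodicPts_nextFun (c : VertexColour) (a : F.CoverEdge b) :
    a ∈ Function.periodicPts (nextFun c) :=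
  ⟨_, Function.minimalPeriod_pos_of_mem_periodicPts (F.rotationSystem.periodic c a.edge),
    iterate_nextFun_minimalPeriod c a⟩

theorem minimalPeriod_nextFun (c : VertexColour) (a : F.CoverEdge b) :
    Function.minimalPeriod (nextFun c) a = Function.minimalPeriod (F.next c) a.edge := by
  apply Nat.dvd_antisymm
  · exact Function.IsPeriodicPt.minimalPeriod_dvd (iterate_nextFun_minimalPeriod c a)
  · refine Function.IsPeriodicPt.minimalPeriod_dvd ?_
    have h := edge_iterate_nextFun c a (Function.minimalPeriod (nextFun c) a)
    rw [Function.iterate_minimalPeriod] at h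
    exact h.symm

theorem nextFun_bijective (c : VertexColour) :
    Function.Bijective (nextFun c : F.CoverEdge b → F.CoverEdge b) := by
  constructor
  · intro a a' h
    have he : a.edge = a'.edge := (F.next c).injective (congrArg edge h)
    have hd : Function.minimalPeriod (nextFun c) a = Function.minimalPeriod (nextFun c) a' := by
      rw [minimalPeriod_nextFun, minimalPeriod_nextFun, he]
    have hpos := Function.minimalPeriod_pos_of_mem_periodicPts (mem_periodicPts_nextFun c a)
    rw [← Function.iterate_minimalPeriod (f := nextFun c) (x := a),
      ← Function.iterate_minimalPeriod (f := nextFun c) (x := a'), ← hd,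
      ← Nat.succ_pred_eq_of_pos hpos, Function.iterate_succ_apply, Function.iterate_succ_apply, h]
  · intro a
    have hpos := Function.minimalPeriod_pos_of_mem_periodicPts (mem_periodicPts_nextFun c a)
    refine ⟨(nextFun c)^[(Function.minimalPeriod (nextFun c) a).pred] a, ?_⟩
    rw [← Function.iterate_succ_apply' (nextFun c), Nat.succ_pred_eq_of_pos hpos,
      Function.iterate_minimalPeriod]

end CoverEdge

open CoverEdge

variable (F b) in
/-- The lifted dual quiver as a rotation system. -/
noncomputable def coverSystem : RotationSystem (F.CoverEdge b) (F.CoverTile b) where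
  tail := CoverEdge.tail
  head := CoverEdge.head
  next c := Equiv.ofBijective _ (nextFun_bijective c)
  tail_next := tail_nextFun
  periodic := mem_periodicPts_nextFun
  next_ne c a h := F.next_ne c a.edge (congrArg edge h)

theorem isCovering_coverSystem :
    (F.coverSystem b).IsCovering F.rotationSystem CoverEdge.edge Sigma.fst where
  tail_map := CoverEdge.tail_edge
  head_map _ := rfl
  next_map _ _ := rfl
  minimalPeriod_map := minimalPeriod_nextFun
  exists_lift x e h := ⟨⟨(x, e), h⟩, rfl, rfl⟩
  lift_unique _ _ := CoverEdge.ext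

theorem CoverEdge.Lifts.exists_isPath {x y : F.CoverTile b} {l : List F.Edge} (h : Lifts x l y) :
    ∃ m, (F.coverSystem b).IsPath x m y ∧ m.map edge = l := by
  induction l generalizing x with
  | nil => exact ⟨[], h.end_unique (Lifts.nil x) ▸ rfl, rfl⟩
  | cons e l ih =>
    have he : F.tail e = x.1 := by
      obtain ⟨p, hp, -⟩ := h
      exact (hp ▸ isPath_edges p : F.rotationSystem.IsPath _ (e :: l) _).1
    let a : F.CoverEdge b := ⟨(x, e), he⟩
    have h' : Lifts a.head l y := by
      obtain ⟨p, hp, hpy⟩ := h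
      have hl : F.rotationSystem.IsPath (F.head e) l y.1 :=
        (hp ▸ isPath_edges p : F.rotationSystem.IsPath _ (e :: l) _).2
      obtain ⟨q, hq⟩ := exists_edges_eq hl
      refine ⟨q, hq, ?_⟩
      have hpq : p = (Quiver.Hom.toPath (⟨e, he, rfl⟩ : x.1 ⟶ F.head e)).comp q := by
        apply edges_injective
        rw [hp, edges_comp, hq]
        rfl
      rw [← hpy, hpq, pathClass_comp, pathClass_toPath, ← Category.assoc]
      rfl
    obtain ⟨m, hm, rfl⟩ := ih h'
    exact ⟨a :: m, ⟨rfl, hm⟩, rfl⟩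

theorem lifts_of_isPath {x y : F.CoverTile b} {m : List (F.CoverEdge b)}
    (h : (F.coverSystem b).IsPath x m y) : Lifts x (m.map edge) y := by
  induction m generalizing x with
  | nil => exact (h : x = y) ▸ Lifts.nil x
  | cons a m ih =>
    obtain ⟨rfl, h⟩ := h
    exact (lifts_head a).append (ih h)

theorem exists_isPath_coverSystem (x y : F.CoverTile b) :
    ∃ m, (F.coverSystem b).IsPath x m y := by
  obtain ⟨p, hp⟩ := exists_pathClass_eq (Groupoid.inv x.2 ≫ y.2)
  have h : Lifts x (edges p) y :=
    ⟨p, rfl, by rw [hp, ← Category.assoc, Groupoid.comp_inv, Category.id_comp]⟩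
  obtain ⟨m, hm, -⟩ := Lifts.exists_isPath h
  exact ⟨m, hm⟩

theorem exists_rep_coverSystem {x y : F.CoverTile b} {u v ω : List (F.CoverEdge b)}
    (hu : (F.coverSystem b).IsPath x u y) (hv : (F.coverSystem b).IsPath x v y)
    (hω : (F.coverSystem b).IsLoop y ω) :
    ∃ m n, (F.coverSystem b).Eqv (u ++ RotationSystem.rep ω m) (v ++ RotationSystem.rep ω n) := by
  have hcov := F.isCovering_coverSystem (b := b)
  obtain ⟨p, hp, hpy⟩ := lifts_of_isPath hu
  obtain ⟨q, hq, hqy⟩ := lifts_of_isPath hv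
  have hpq : pathClass p = pathClass q := by
    rw [← Category.id_comp (pathClass p), ← Groupoid.inv_comp x.2, Category.assoc, hpy, ← hqy,
      ← Category.assoc, Groupoid.inv_comp, Category.id_comp]
  obtain ⟨m, n, h⟩ := (weak_of_pathClass_eq hpq).exists_rep isPolygonal (hcov.isLoop_map hω)
  refine ⟨m, n, hcov.eqv_of_map (hu.append (RotationSystem.isPath_rep hω.isPath m))
    (hv.append (RotationSystem.isPath_rep hω.isPath n)) ?_⟩
  rwa [List.map_append, List.map_append, RotationSystem.map_rep, RotationSystem.map_rep, ← hp,
    ← hq]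

theorem Consistent.cancel_coverSystem (hF : F.Consistent) {x y : F.CoverTile b}
    {u v ω : List (F.CoverEdge b)} (hu : (F.coverSystem b).IsPath x u y)
    (hv : (F.coverSystem b).IsPath x v y) (hω : (F.coverSystem b).IsLoop y ω)
    (h : (F.coverSystem b).Eqv (u ++ ω) (v ++ ω)) : (F.coverSystem b).Eqv u v := by
  have hcov := F.isCovering_coverSystem (b := b)
  refine hcov.eqv_of_map hu hv (hF.cancel (hcov.isPath_map hu) (hcov.isPath_map hv)
    (hcov.isLoop_map hω) ?_)
  simpa using hcov.eqv_map h

theorem Consistent.isConsistentPlane (hF : F.Consistent)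
    (hfin : (F.coverSystem b).HasNoFiniteComponent) : (F.coverSystem b).IsConsistentPlane where
  isPolygonal := isCovering_coverSystem.isPolygonal isPolygonal
  exists_tail_eq x := by
    obtain ⟨e, he⟩ := F.tail_surjective x.1
    exact ⟨⟨(x, e), he⟩, rfl⟩
  finite_tail_eq x := by
    refine Set.Finite.of_finite_image (f := edge) (Set.toFinite _) ?_
    exact fun a ha a' ha' h => CoverEdge.ext (Eq.trans ha (Eq.symm ha')) h
  cancel := hF.cancel_coverSystem
  exists_rep := exists_rep_coverSystem
  exists_isPath := exists_isPath_coverSystem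
  hasNoFiniteComponent := hfin

/-! ### Transfer to paths in the lifted quiver. -/

/-- The list of the arrows of a path in the lifted quiver. -/
def coverEdges {x : F.CoverTile b} : {y : F.CoverTile b} → Quiver.Path x y → List (F.CoverEdge b)
  | _, .nil => []
  | _, .cons (b := y) p a => coverEdges p ++ [⟨(y, a.1.1), a.1.2.1⟩]

theorem coverEdges_cons {x y z : F.CoverTile b} (p : Quiver.Path x y) (a : y ⟶ z) :
    coverEdges (p.cons a) = coverEdges p ++ [⟨(y, a.1.1), a.1.2.1⟩] := rfl

theorem coverEdges_comp {x y z : F.CoverTile b} (p : Quiver.Path x y) (q : Quiver.Path y z) :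
    coverEdges (p.comp q) = coverEdges p ++ coverEdges q := by
  induction q with
  | nil => exact (List.append_nil _).symm
  | cons q a ih =>
    rw [Quiver.Path.comp_cons, coverEdges_cons, ih, coverEdges_cons, List.append_assoc]

theorem map_coverEdges {x y : F.CoverTile b} (p : Quiver.Path x y) :
    (coverEdges p).map edge = edges ((F.coverProj b).mapPath p) := by
  induction p with
  | nil => rfl
  | cons p a ih =>
    rw [coverEdges_cons, List.map_append, ih]
    rfl

theorem head_of_hom {x y : F.CoverTile b} (a : x ⟶ y) :
    CoverEdge.head (⟨(x, a.1.1), a.1.2.1⟩ : F.CoverEdge b) = y :=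
  (lifts_head _).end_unique ⟨a.1.toPath, rfl,
    (congrArg (x.2 ≫ ·) (pathClass_toPath a.1)).trans a.2⟩

theorem isPath_coverEdges {x y : F.CoverTile b} (p : Quiver.Path x y) :
    (F.coverSystem b).IsPath x (coverEdges p) y := by
  induction p with
  | nil => rfl
  | cons p a ih => exact ih.append ⟨rfl, head_of_hom a⟩

/-- The arrow of the lifted quiver given by an edge of the lifted tiling. -/
def CoverEdge.hom (a : F.CoverEdge b) : a.tail ⟶ a.head :=
  ⟨⟨a.edge, a.tail_edge, rfl⟩, rfl⟩

theorem exists_coverEdges_eq {x y : F.CoverTile b} {l : List (F.CoverEdge b)}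
    (h : (F.coverSystem b).IsPath x l y) : ∃ p : Quiver.Path x y, coverEdges p = l := by
  induction l generalizing x with
  | nil =>
    obtain rfl : x = y := h
    exact ⟨.nil, rfl⟩
  | cons a l ih =>
    obtain ⟨rfl, h⟩ := h
    obtain ⟨p, rfl⟩ := ih h
    exact ⟨a.hom.toPath.comp p, coverEdges_comp _ _⟩

theorem isMinimalPath_of_isMinimal {x y : F.CoverTile b} {p : Quiver.Path x y}
    (h : (F.coverSystem b).IsMinimal (coverEdges p)) : IsMinimalPath p := by
  rintro ⟨z, u, ω, v, hω, hp⟩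
  have hcov := F.isCovering_coverSystem (b := b)
  refine h ⟨z, coverEdges u, coverEdges ω, coverEdges v, ?_, ?_⟩
  · refine hcov.isLoop_of_map (isPath_coverEdges ω) (j := z.1) ?_
    rw [map_coverEdges]
    exact isLoop_edges hω
  · rw [← coverEdges_comp, ← coverEdges_comp]
    refine hcov.eqv_of_map (isPath_coverEdges p) (isPath_coverEdges _) ?_
    rw [map_coverEdges, map_coverEdges]
    exact eqv_edges hp

theorem mr2_of_isConsistentPlane
    (h : ∀ b : F.Tile, (F.coverSystem b).IsConsistentPlane) : F.MR2 := by
  constructor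
  · intro b i j
    obtain ⟨a, m, rfl, hm, hmin⟩ := (h b).exists_isMinimal_append i j
    obtain ⟨p, rfl⟩ := exists_coverEdges_eq hm
    exact ⟨_, a.hom, p.cons a.hom, isMinimalPath_of_isMinimal hmin, p, .nil, rfl⟩
  · intro b i j
    obtain ⟨a, m, rfl, hm, hmin⟩ := (h b).exists_isMinimal_cons i j
    obtain ⟨p, rfl⟩ : ∃ p : Quiver.Path a.head i, coverEdges p = m := exists_coverEdges_eq hm
    refine ⟨_, a.hom, a.hom.toPath.comp p, isMinimalPath_of_isMinimal ?_, .nil, p, ?_⟩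
    · rw [coverEdges_comp]
      exact hmin
    · exact (congrArg (Quiver.Path.comp · p) (Quiver.Path.nil_comp a.hom.toPath)).symm

end BraneTiling

/-! ### In positive genus the cover has no finite component. -/

namespace BraneTiling

variable {g : ℕ} {F : BraneTiling.{u} g}

section Cocycle

variable (F)

/-- The vertices of colour `c`. -/
abbrev Vertex (c : VertexColour) : Type u :=
  _root_.Quotient (Equiv.Perm.SameCycle.setoid (F.next c))

instance finiteTile : Finite F.Tile := Finite.of_surjective F.tail F.tail_surjective

open Classical in
/-- The sums of a function on edges around the vertices of colour `c`. -/
noncomputable def vertexSum [Fintype F.Edge] (c : VertexColour) :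
    (F.Edge → ℚ) →ₗ[ℚ] (F.Vertex c → ℚ) where
  toFun φ v := ∑ e with (Quotient.mk'' e : F.Vertex c) = v, φ e
  map_add' _ _ := funext fun _ => Finset.sum_add_distrib
  map_smul' _ _ := funext fun _ => (Finset.mul_sum _ _ _).symm

/-- The difference of a function on tiles across the edges. -/
def coboundary : (F.Tile → ℚ) →ₗ[ℚ] (F.Edge → ℚ) where
  toFun f e := f (F.head e) - f (F.tail e)
  map_add' f f' := funext fun e => by simp only [Pi.add_apply]; ring
  map_smul' r f := funext fun e => by simp only [Pi.smul_apply, smul_eq_mul, RingHom.id_apply]; ring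

theorem sum_vertexSum [Fintype F.Edge] (c : VertexColour) [Fintype (F.Vertex c)]
    (φ : F.Edge → ℚ) : ∑ v, F.vertexSum c φ v = ∑ e, φ e := by
  classical
  exact Finset.sum_fiberwise _ _ _

/-- In positive genus there is a closed 1-cochain that is not exact. -/
theorem exists_cocycle [Fintype F.Edge] (hg : 1 ≤ g) :
    ∃ φ : F.Edge → ℚ, (∀ c, F.vertexSum c φ = 0) ∧ φ ∉ LinearMap.range F.coboundary := by
  have := Fintype.ofFinite F.Tile
  have : ∀ c, Fintype (F.Vertex c) := fun c => Fintype.ofFinite _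
  obtain ⟨e₀⟩ := F.nonempty_edge
  by_contra! hcon
  let D := (F.vertexSum .black).prod (F.vertexSum .white)
  have hker : LinearMap.ker D ≤ LinearMap.range F.coboundary := by
    intro φ hφ
    have h : (F.vertexSum .black φ, F.vertexSum .white φ) = 0 := hφ
    rw [Prod.mk_eq_zero] at h
    exact hcon φ (by rintro (_ | _) <;> simp [h])
  let s : ((F.Vertex .black → ℚ) × (F.Vertex .white → ℚ)) →ₗ[ℚ] ℚ :=
    (∑ v, LinearMap.proj v) ∘ₗ LinearMap.fst ℚ _ _ -
      (∑ v, LinearMap.proj v) ∘ₗ LinearMap.snd ℚ _ _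
  have hs : ∀ x, s x = ∑ v, x.1 v - ∑ v, x.2 v := fun x => by simp [s]
  have hsurj : LinearMap.range s = ⊤ := by
    classical
    refine LinearMap.range_eq_top.2 fun r => ⟨(Pi.single (Quotient.mk'' e₀) r, 0), ?_⟩
    rw [hs]
    simp
  -- Every edge has one end of each colour, so the black and white totals both equal the sum over
  -- all edges.
  have hDs : LinearMap.range D ≤ LinearMap.ker s := by
    rintro _ ⟨φ, rfl⟩
    rw [LinearMap.mem_ker, hs]
    change ∑ v, F.vertexSum .black φ v - ∑ v, F.vertexSum .white φ v = 0
    rw [sum_vertexSum, sum_vertexSum, sub_self]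
  have hconst : 1 ≤ Module.finrank ℚ (LinearMap.ker F.coboundary) := by
    have hmem : (fun _ => 1 : F.Tile → ℚ) ∈ LinearMap.ker F.coboundary :=
      LinearMap.mem_ker.2 (funext fun e => sub_self _)
    have : Nontrivial (LinearMap.ker F.coboundary) := by
      refine ⟨⟨⟨_, hmem⟩, 0, fun h => ?_⟩⟩
      have := congrFun (congrArg Subtype.val h) (F.tail e₀)
      simp at this
    exact Module.finrank_pos
  -- With B, W, E and T the numbers of black vertices, white vertices, edges and tiles, these ranks
  -- give E ≤ (B + W - 1) + (T - 1) = E - 2g, which contradicts `1 ≤ g`.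
  have h1 := LinearMap.finrank_range_add_finrank_ker D
  have h2 := LinearMap.finrank_range_add_finrank_ker s
  have h3 := LinearMap.finrank_range_add_finrank_ker F.coboundary
  have h4 := Submodule.finrank_mono hker
  have h5 := Submodule.finrank_mono hDs
  rw [hsurj, finrank_top, Module.finrank_self, Module.finrank_prod, Module.finrank_fintype_fun_eq_card,
    Module.finrank_fintype_fun_eq_card] at h2
  rw [Module.finrank_fintype_fun_eq_card] at h1 h3
  have heuler := F.euler
  rw [Nat.card_eq_fintype_card, Nat.card_eq_fintype_card, Nat.card_eq_fintype_card,
    Nat.card_eq_fintype_card] at heuler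
  change (Fintype.card (F.Vertex .black) : ℤ) + Fintype.card (F.Vertex .white) - _ + _ = _ at heuler
  omega

end Cocycle

open CoverEdge

section Height

/-- The function `φ` on arrows as a map to the groupoid with one object and morphisms `ℚ`. -/
def cochainPrefunctor (φ : F.Edge → ℚ) : F.Tile ⥤q SingleObj (Multiplicative ℚ) where
  obj _ := SingleObj.star _
  map a := Multiplicative.ofAdd (φ a.1)

theorem cochainPrefunctor_mapPath (φ : F.Edge → ℚ) {i j : F.Tile} (p : Quiver.Path i j) :
    composePath ((cochainPrefunctor φ).mapPath p) =
      Multiplicative.ofAdd ((edges p).map φ).sum := by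
  induction p with
  | nil => rfl
  | cons p a ih =>
    rw [edges_cons, List.map_append, List.sum_append, add_comm, ofAdd_add, ← ih]
    exact congrArg (· * _) (by simp [cochainPrefunctor])

variable [Fintype F.Edge] {φ : F.Edge → ℚ} (hφ : ∀ c, F.vertexSum c φ = 0)

include hφ in
theorem sum_edges_of_isSimpleLoop {i : F.Tile} {ω : Quiver.Path i i} (h : IsSimpleLoop ω) :
    ((edges ω).map φ).sum = 0 := by
  classical
  obtain ⟨c, e⟩ := h
  have hper := F.rotationSystem.periodic c e
  have hnd : (e :: around (F.next c) e).Nodup := nodup_cons_around hper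
  rw [edges_arrow_comp_brokenLoop, ← List.sum_toFinset φ hnd]
  have h := congrFun (hφ c) (Quotient.mk'' e)
  refine Eq.trans (Finset.sum_congr ?_ fun _ _ => rfl) h
  ext f
  have hmem : f ∈ e :: around (F.next c) e ↔ (F.next c).SameCycle e f :=
    mem_cons_around_iff hper
  rw [List.mem_toFinset, hmem, Finset.mem_filter, Quotient.eq'']
  exact ⟨fun h => ⟨Finset.mem_univ _, h.symm⟩, fun h => h.2.symm⟩

include hφ in
theorem composePath_cochainPrefunctor {i : F.Tile} (ω : Quiver.Path i i) (h : IsSimpleLoop ω) :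
    composePath ((cochainPrefunctor φ).mapPath ω) = 𝟙 _ := by
  rw [cochainPrefunctor_mapPath, sum_edges_of_isSimpleLoop hφ h]
  rfl

/-- The functor integrating a closed 1-cochain along homotopy classes. -/
def integral : F.FundGroupoid ⥤ SingleObj (Multiplicative ℚ) :=
  fundLift (cochainPrefunctor φ) (composePath_cochainPrefunctor hφ)

variable {b : F.Tile}

/-- A primitive of a closed 1-cochain on the universal cover. -/
def height (x : F.CoverTile b) : ℚ := Multiplicative.toAdd ((integral hφ).map x.2)

theorem height_head (a : F.CoverEdge b) : height hφ a.head = height hφ a.tail + φ a.edge := by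
  have h : (integral hφ).map (fundClass (⟨a.edge, a.tail_edge, rfl⟩ : a.tail.1 ⟶ F.head a.edge))
      = Multiplicative.ofAdd (φ a.edge) := by
    rw [← pathClass_toPath]
    refine (fundLift_map_pathClass _ (composePath_cochainPrefunctor hφ) _).trans ?_
    rw [cochainPrefunctor_mapPath]
    simp
  have h2 := (integral hφ).map_comp a.tail.2
    (fundClass (⟨a.edge, a.tail_edge, rfl⟩ : a.tail.1 ⟶ F.head a.edge))
  rw [h] at h2
  exact (congrArg Multiplicative.toAdd h2).trans (add_comm _ _)

end Height

/-- On a finite component the primitive of a closed cochain attains a maximum over the lifts of each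
tile. These maxima form a function on the tiles of `F` whose coboundary is the cochain, which was
chosen not to be exact. -/
theorem hasNoFiniteComponent_coverSystem (hg : 1 ≤ g) (b : F.Tile) :
    (F.coverSystem b).HasNoFiniteComponent := by
  intro A hA hnext
  have := Fintype.ofFinite F.Edge
  obtain ⟨φ, hφ, hφ'⟩ := F.exists_cocycle hg
  by_contra hne
  obtain ⟨a₀, ha₀⟩ := Set.nonempty_iff_ne_empty.2 hne
  have hconn : ∀ e, ∃ a ∈ A, a.edge = e := by
    intro e
    obtain ⟨π, hπ, rfl⟩ := F.connected a₀.edge e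
    -- The statement for the inverse is carried along so that the induction passes through inverses.
    have key : (∀ a ∈ A, ∃ a' ∈ A, a'.edge = π a.edge) ∧
        (∀ a ∈ A, ∃ a' ∈ A, a'.edge = π⁻¹ a.edge) := by
      induction hπ using Subgroup.closure_induction with
      | mem π hπ =>
        obtain ⟨c, rfl⟩ := hπ
        refine ⟨fun a ha => ⟨_, hnext c a ha, rfl⟩,
          fun a ha => ⟨_, RotationSystem.inv_next_mem hnext c ha, ?_⟩⟩
        rw [Equiv.Perm.eq_inv_iff_eq]
        exact congrArg edge (perm_apply_inv_apply ((F.coverSystem b).next c) a)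
      | one => exact ⟨fun a ha => ⟨a, ha, rfl⟩, fun a ha => ⟨a, ha, rfl⟩⟩
      | mul π π' _ _ h h' =>
        constructor
        · intro a ha
          obtain ⟨a', ha', he'⟩ := h'.1 a ha
          obtain ⟨a'', ha'', he''⟩ := h.1 a' ha'
          exact ⟨a'', ha'', by rw [he'', he', Equiv.Perm.mul_apply]⟩
        · intro a ha
          obtain ⟨a', ha', he'⟩ := h.2 a ha
          obtain ⟨a'', ha'', he''⟩ := h'.2 a' ha'
          exact ⟨a'', ha'', by rw [he'', he', mul_inv_rev, Equiv.Perm.mul_apply]⟩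
      | inv π _ h => exact ⟨h.2, by rw [inv_inv]; exact h.1⟩
    exact key.1 a₀ ha₀
  have hmem : ∀ {a a' : F.CoverEdge b}, a ∈ A → a.tail = a'.tail → a' ∈ A := fun ha h =>
    RotationSystem.mem_of_tail_eq (isCovering_coverSystem.isPolygonal isPolygonal) hnext ha h
  have hmax : ∀ j, ∃ a ∈ A, a.tail.1 = j ∧
      ∀ a' ∈ A, a'.tail.1 = j → height hφ a'.tail ≤ height hφ a.tail := by
    intro j
    obtain ⟨e, rfl⟩ := F.tail_surjective j
    obtain ⟨a, ha, rfl⟩ := hconn e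
    obtain ⟨m, hm, hmax⟩ := Set.exists_max_image {a' ∈ A | a'.tail.1 = F.tail a.edge}
      (fun a' => height hφ a'.tail) (hA.subset fun _ h => h.1) ⟨a, ha, a.tail_edge.symm⟩
    exact ⟨m, hm.1, hm.2, fun a' h h' => hmax a' ⟨h, h'⟩⟩
  choose m hmA hm hmax using hmax
  refine hφ' ⟨fun j => height hφ (m j).tail, funext fun e => ?_⟩
  change height hφ (m (F.head e)).tail - height hφ (m (F.tail e)).tail = φ e
  -- Lift `e` to start at the highest lift of its tail; the end of this lift is no higher than the
  -- maximum over the head. For the reverse inequality, `e` is lifted to end at the highest lift of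
  -- its head.
  have hle : height hφ (m (F.tail e)).tail + φ e ≤ height hφ (m (F.head e)).tail := by
    let a : F.CoverEdge b := ⟨((m (F.tail e)).tail, e), (hm _).symm⟩
    have ha : a ∈ A := hmem (hmA (F.tail e)) rfl
    have hh : (nextFun .black a).tail = a.head := tail_nextFun .black a
    have h := hmax (F.head e) _ (hnext .black a ha) (congrArg Sigma.fst hh)
    change height hφ (nextFun .black a).tail ≤ _ at h
    rwa [hh, height_head] at h
  have hge : height hφ (m (F.head e)).tail ≤ height hφ (m (F.tail e)).tail + φ e := by
    let a' : F.CoverEdge b := ⟨((m (F.head e)).tail, F.next .black e),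
      (F.tail_next .black e).trans (hm _).symm⟩
    have ha' : a' ∈ A := hmem (hmA (F.head e)) rfl
    obtain ⟨a, haa'⟩ := (nextFun_bijective .black).2 a'
    have ha : a ∈ A := by
      have h := RotationSystem.inv_next_mem hnext .black ha'
      rwa [Equiv.Perm.inv_eq_iff_eq.2 (show a' = (F.coverSystem b).next .black a from haa'.symm)]
        at h
    have hae : a.edge = e := (F.next .black).injective (congrArg edge haa')
    have hh : a.head = (m (F.head e)).tail :=
      (tail_nextFun .black a).symm.trans
        (show (nextFun .black a).tail = a'.tail from congrArg CoverEdge.tail haa')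
    have h := hmax (F.tail e) a ha (by rw [← a.tail_edge, hae])
    rw [← hh, height_head, hae]
    linarith
  linarith

end BraneTiling

theorem lemma6p3 {g : ℕ} (hg : 1 ≤ g) (F : BraneTiling.{u} g) (hF : F.Consistent) : F.MR2 :=
  BraneTiling.mr2_of_isConsistentPlane fun b =>
    hF.isConsistentPlane (BraneTiling.hasNoFiniteComponent_coverSystem hg b)
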